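/- Let $k$ be an arbitrary field. A Kronecker module is a finite-dimensional right module over the path algebra of the Kronecker quiver over $k$, equivalently a finite-dimensional representation $V_1\leftleftarrows V_2$, i.e. two finite-dimensional $k$-vector spaces with two linear maps $a,b:V_2\to V_1$; its dimension vector is $(\dim_k V_1,\dim_k V_2)$. For $n\ge 0$ let $P_n$ be the preprojective indecomposable of dimension vector $(n+1,n)$, given by $k^{n+1}\leftleftarrows k^n$ with the matrices $\binom{E_n}{0}$ and $\binom{0}{E_n}$, where $E_n$ is the identity matrix, and let $I_n$ be the preinjective indecomposable of dimension vector $(n,n+1)$, given by the transposed matrices. An indecomposable Kronecker module is regular if it is isomorphic to no $P_n$ and to no $I_n$; a Kronecker module is regular if it is a finite direct sum of regular indecomposables. For a closed point $x$ of $\mathbb P^1_k$ and $t\ge 1$ let $R_x(t)$ be the regular indecomposable of regular length $t$ in the tube at $x$: if $x$ is the point of $\mathbb A^1_k=\operatorname{Spec} k[T]$ given by the maximal ideal $\mathfrak m$, then $V_1=V_2=k[T]/\mathfrak m^t$, $a$ is the identity and $b$ is multiplication by $T$; if $x=\infty$, then $V_1=V_2=k[T]/(T^t)$, $a$ is multiplication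 by $T$ and $b$ is the identity. Let $0\le n<m$ be integers and let $X$ be a Kronecker module. Then there is a short exact sequence $0\to P_n\to P_m\to X\to 0$ if and only if $X$ satisfies the following two conditions: (i) $X$ is a regular module with $\underline{\dim}\, X=\underline{\dim}\, P_m-\underline{\dim}\, P_n$; (ii) whenever $X$ is decomposed into a direct sum of indecomposables and two summands at different places of the decomposition are isomorphic to $R_x(t)$ and $R_{x'}(t')$ respectively, then $x\neq x'$ (that is, the indecomposable summands of $X$ lie in pairwise distinct tubes). -/

import Mathlib

open Polynomial Module

/-- A Kronecker module over `k`: a finite-dimensional representation of the Kronecker quiver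
`1 ⇇ 2`, that is, two finite-dimensional spaces and two linear maps from the space at vertex `2`
to the space at vertex `1`. -/
structure KroneckerModule.{u} (k : Type u) [Field k] where
  V₁ : Type u
  V₂ : Type u
  [addCommGroup₁ : AddCommGroup V₁]
  [addCommGroup₂ : AddCommGroup V₂]
  [module₁ : Module k V₁]
  [module₂ : Module k V₂]
  [finite₁ : Module.Finite k V₁]
  [finite₂ : Module.Finite k V₂]
  a : V₂ →ₗ[k] V₁
  b : V₂ →ₗ[k] V₁

namespace KroneckerModule

universe u

attribute [instance] addCommGroup₁ addCommGroup₂ module₁ module₂ finite₁ finite₂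

variable {k : Type u} [Field k]

/-- Morphisms of Kronecker modules. -/
@[ext]
structure Hom (M N : KroneckerModule k) where
  φ₁ : M.V₁ →ₗ[k] N.V₁
  φ₂ : M.V₂ →ₗ[k] N.V₂
  comm_a : φ₁ ∘ₗ M.a = N.a ∘ₗ φ₂
  comm_b : φ₁ ∘ₗ M.b = N.b ∘ₗ φ₂

/-- `M` and `N` are isomorphic: there are linear isomorphisms at the two vertices which commute
with the structure maps. -/
def IsIso (M N : KroneckerModule k) : Prop :=
  ∃ (e₁ : M.V₁ ≃ₗ[k] N.V₁) (e₂ : M.V₂ ≃ₗ[k] N.V₂),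
    (∀ v, e₁ (M.a v) = N.a (e₂ v)) ∧ ∀ v, e₁ (M.b v) = N.b (e₂ v)

/-- The sequence `0 → L → M → N → 0` given by `f` and `g` is exact. -/
def IsShortExact {L M N : KroneckerModule k} (f : Hom L M) (g : Hom M N) : Prop :=
  (Function.Injective f.φ₁ ∧ Function.Exact f.φ₁ g.φ₁ ∧ Function.Surjective g.φ₁) ∧
  (Function.Injective f.φ₂ ∧ Function.Exact f.φ₂ g.φ₂ ∧ Function.Surjective g.φ₂)

/-- The dimension vector, with integer entries so that differences can be formed. -/
noncomputable def dimVec (M : KroneckerModule k) : ℤ × ℤ :=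
  (finrank k M.V₁, finrank k M.V₂)

/-- The zero module. -/
def IsZero (M : KroneckerModule k) : Prop :=
  Subsingleton M.V₁ ∧ Subsingleton M.V₂

/-- The direct sum of two Kronecker modules. -/
def prod (M N : KroneckerModule k) : KroneckerModule k where
  V₁ := M.V₁ × N.V₁
  V₂ := M.V₂ × N.V₂
  a := LinearMap.prodMap M.a N.a
  b := LinearMap.prodMap M.b N.b

/-- The direct sum of a finite family of Kronecker modules. -/
def directSum {r : ℕ} (Y : Fin r → KroneckerModule k) : KroneckerModule k where
  V₁ := ∀ i, (Y i).V₁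
  V₂ := ∀ i, (Y i).V₂
  a := LinearMap.pi fun i => (Y i).a ∘ₗ LinearMap.proj i
  b := LinearMap.pi fun i => (Y i).b ∘ₗ LinearMap.proj i

/-- Indecomposable Kronecker modules. -/
def Indecomposable (M : KroneckerModule k) : Prop :=
  ¬ M.IsZero ∧ ∀ A B : KroneckerModule k, M.IsIso (A.prod B) → A.IsZero ∨ B.IsZero

/-- The `(n+1) × n` matrix with the identity in the first `n` rows and last row zero. -/
def upperBlock (k : Type u) [Field k] (n : ℕ) : Matrix (Fin (n + 1)) (Fin n) k :=
  Matrix.of fun i j => if i = j.castSucc then 1 else 0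

/-- The `(n+1) × n` matrix with first row zero and the identity in the last `n` rows. -/
def lowerBlock (k : Type u) [Field k] (n : ℕ) : Matrix (Fin (n + 1)) (Fin n) k :=
  Matrix.of fun i j => if i = j.succ then 1 else 0

/-- The preprojective indecomposable `Pₙ`, of dimension vector `(n + 1, n)`. -/
noncomputable def P (k : Type u) [Field k] (n : ℕ) : KroneckerModule k where
  V₁ := Fin (n + 1) → k
  V₂ := Fin n → k
  a := Matrix.toLin' (upperBlock k n)
  b := Matrix.toLin' (lowerBlock k n)

/-- The preinjective indecomposable `Iₙ`, of dimension vector `(n, n + 1)`. -/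
noncomputable def I (k : Type u) [Field k] (n : ℕ) : KroneckerModule k where
  V₁ := Fin n → k
  V₂ := Fin (n + 1) → k
  a := Matrix.toLin' (upperBlock k n).transpose
  b := Matrix.toLin' (lowerBlock k n).transpose

/-- Regular indecomposables: the indecomposables that are neither preprojective nor
preinjective. -/
def IsRegularIndecomposable (M : KroneckerModule k) : Prop :=
  M.Indecomposable ∧ (∀ n, ¬ M.IsIso (P k n)) ∧ ∀ n, ¬ M.IsIso (I k n)

/-- Regular modules: finite direct sums of regular indecomposables. -/
def IsRegular (M : KroneckerModule k) : Prop :=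
  ∃ (r : ℕ) (Y : Fin r → KroneckerModule k),
    (∀ i, (Y i).IsRegularIndecomposable) ∧ M.IsIso (directSum Y)

/-- The closed points of the projective line over `k`: those of the affine line `Spec k[X]`,
that is, the maximal ideals of `k[X]`, and the point at infinity. -/
inductive ClosedPoint (k : Type u) [Field k] : Type u
  | affine (𝔪 : MaximalSpectrum k[X])
  | infty

theorem finite_quotient_pow (𝔪 : Ideal k[X]) (h : 𝔪 ≠ ⊥) (t : ℕ) :
    Module.Finite k (k[X] ⧸ 𝔪 ^ t) := by
  obtain ⟨f, hf, hf0⟩ := Submodule.exists_mem_ne_zero_of_ne_bot (pow_ne_zero t h)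
  have h1 : Module.Finite k (k[X] ⧸ Ideal.span {f}) :=
    (AdjoinRoot.powerBasis hf0).finite
  have hle : Ideal.span {f} ≤ 𝔪 ^ t := (Ideal.span_singleton_le_iff_mem _).2 hf
  exact Module.Finite.of_surjective (Ideal.Quotient.factorₐ k hle).toLinearMap
    (Ideal.Quotient.factor_surjective hle)

theorem maximal_ne_bot (𝔪 : MaximalSpectrum k[X]) : 𝔪.asIdeal ≠ ⊥ :=
  Ring.ne_bot_of_isMaximal_of_not_isField 𝔪.isMaximal (Polynomial.not_isField k)

/-- The regular module `R_x(t)`, which for `t ≥ 1` is the indecomposable of regular length `t` in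
the tube at `x`. At the maximal ideal `𝔪` of `k[X]` both spaces are `k[X] ⧸ 𝔪 ^ t`, with structure
maps the identity and multiplication by `X`; at infinity both spaces are `k[X] ⧸ (X) ^ t`, with
structure maps multiplication by `X` and the identity. -/
noncomputable def R : ClosedPoint k → ℕ → KroneckerModule k
  | .affine 𝔪, t =>
    haveI := finite_quotient_pow 𝔪.asIdeal (maximal_ne_bot 𝔪) t
    { V₁ := k[X] ⧸ 𝔪.asIdeal ^ t
      V₂ := k[X] ⧸ 𝔪.asIdeal ^ t
      a := LinearMap.id
      b := LinearMap.mulLeft k (Ideal.Quotient.mk (𝔪.asIdeal ^ t) X) }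
  | .infty, t =>
    haveI := finite_quotient_pow (k := k) (Ideal.span {X})
      (by simp) t
    { V₁ := k[X] ⧸ (Ideal.span {X} : Ideal k[X]) ^ t
      V₂ := k[X] ⧸ (Ideal.span {X} : Ideal k[X]) ^ t
      a := LinearMap.mulLeft k (Ideal.Quotient.mk ((Ideal.span {X} : Ideal k[X]) ^ t) X)
      b := LinearMap.id }

/-- `M` is (isomorphic to) one of the indecomposables in the tube at `x`. -/
def InTube (x : ClosedPoint k) (M : KroneckerModule k) : Prop :=
  ∃ t : ℕ, 1 ≤ t ∧ M.IsIso (R x t)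

/-- Whenever `M` is decomposed into indecomposables, any two summands `R_x(t)` and `R_{x'}(t')` at
different places of the decomposition have `x ≠ x'`. -/
def SummandsInDistinctTubes (M : KroneckerModule k) : Prop :=
  ∀ (r : ℕ) (Y : Fin r → KroneckerModule k), (∀ i, (Y i).Indecomposable) →
    M.IsIso (directSum Y) →
    ∀ i j, i ≠ j → ∀ x x' : ClosedPoint k, InTube x (Y i) → InTube x' (Y j) → x ≠ x'

end KroneckerModule

/-! ### Isomorphisms, and indecomposability through idempotents -/

namespace KroneckerModule

universe u

variable {k : Type u} [Field k]

/-! Read `P k n` as pairs of polynomials of degree at most `n` and less than `n`, with structure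
maps the inclusion and multiplication by `X`. A morphism from `P k n` to `P k m` is then
multiplication by one polynomial `F` (`exists_hom_apply_eq_mul`). A nonzero `F` has degree at most
`d = m - n` and stands for a binary form of degree `d`, with `d - deg F` its multiplicity at
infinity. Factoring the form into powers attached to distinct closed points and applying the Chinese
remainder theorem gives the cokernel as the direct sum of the corresponding `R x t`
(`exists_isShortExact`). Surjectivity follows from exactness by counting dimensions.

For the forward direction, this shows that the cokernel is regular. The tubes are distinct because
`P k m` is cyclic over `k[X]` at vertex 1, so it cannot map onto two modules in one tube
(`not_jointly_surjective`).

For the converse, the summands of `X` must be recognised as modules `R x t`. Reflection shows that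
an indecomposable with `dim V₁ < dim V₂` is preinjective, so equality of the total dimensions forces
equality in each regular summand. In an indecomposable of equal dimensions one structure map is
bijective, and the structure theorem over `k[X]` applies (`Indecomposable.exists_inTube`). The
product of the prime powers at the resulting distinct points is the required `F`. -/

theorem IsIso.symm {M N : KroneckerModule k} (h : M.IsIso N) : N.IsIso M := by
  obtain ⟨e₁, e₂, ha, hb⟩ := h
  refine ⟨e₁.symm, e₂.symm, fun v => ?_, fun v => ?_⟩
  · rw [LinearEquiv.symm_apply_eq, ha, LinearEquiv.apply_symm_apply]
  · rw [LinearEquiv.symm_apply_eq, hb, LinearEquiv.apply_symm_apply]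

theorem IsIso.trans {M N L : KroneckerModule k} (h : M.IsIso N) (h' : N.IsIso L) : M.IsIso L := by
  obtain ⟨e₁, e₂, ha, hb⟩ := h
  obtain ⟨f₁, f₂, ha', hb'⟩ := h'
  exact ⟨e₁.trans f₁, e₂.trans f₂, fun v => by simp [ha, ha'], fun v => by simp [hb, hb']⟩

theorem IsIso.finrank₁ {M N : KroneckerModule k} (h : M.IsIso N) :
    finrank k M.V₁ = finrank k N.V₁ := by
  obtain ⟨e₁, -, -, -⟩ := h
  exact e₁.finrank_eq

theorem IsIso.finrank₂ {M N : KroneckerModule k} (h : M.IsIso N) :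
    finrank k M.V₂ = finrank k N.V₂ := by
  obtain ⟨-, e₂, -, -⟩ := h
  exact e₂.finrank_eq

theorem IsIso.directSum {r : ℕ} {Y Z : Fin r → KroneckerModule k} (h : ∀ i, (Y i).IsIso (Z i)) :
    (directSum Y).IsIso (directSum Z) := by
  choose e₁ e₂ ha hb using h
  exact ⟨LinearEquiv.piCongrRight e₁, LinearEquiv.piCongrRight e₂,
    fun v => funext fun i => ha i (v i), fun v => funext fun i => hb i (v i)⟩

/-- The module with its two structure maps interchanged. -/
def swap (M : KroneckerModule k) : KroneckerModule k where
  V₁ := M.V₁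
  V₂ := M.V₂
  a := M.b
  b := M.a

/-- Every idempotent endomorphism is `0` or `1`. -/
def TrivialIdempotents (M : KroneckerModule k) : Prop :=
  ∀ (e₁ : M.V₁ →ₗ[k] M.V₁) (e₂ : M.V₂ →ₗ[k] M.V₂),
    (∀ v, e₁ (M.a v) = M.a (e₂ v)) → (∀ v, e₁ (M.b v) = M.b (e₂ v)) →
    (∀ v, e₁ (e₁ v) = e₁ v) → (∀ v, e₂ (e₂ v) = e₂ v) →
    ((∀ v, e₁ v = 0) ∧ ∀ v, e₂ v = 0) ∨ ((∀ v, e₁ v = v) ∧ ∀ v, e₂ v = v)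

/-- Range and kernel of an idempotent endomorphism are complementary submodules. The idempotent
criterion transfers more easily than decompositions, to `swap` and to `reflection`. -/
theorem Indecomposable.trivialIdempotents {M : KroneckerModule k} (h : M.Indecomposable) :
    M.TrivialIdempotents := by
  intro e₁ e₂ ha hb h₁ h₂
  let A : KroneckerModule k :=
    { V₁ := LinearMap.range e₁
      V₂ := LinearMap.range e₂
      a := M.a.restrict (by rintro _ ⟨v, rfl⟩; exact ⟨M.a v, ha v⟩)
      b := M.b.restrict (by rintro _ ⟨v, rfl⟩; exact ⟨M.b v, hb v⟩) }
  let B : KroneckerModule k :=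
    { V₁ := LinearMap.ker e₁
      V₂ := LinearMap.ker e₂
      a := M.a.restrict (fun v hv => by
        rw [LinearMap.mem_ker] at hv ⊢; rw [ha, hv, map_zero])
      b := M.b.restrict (fun v hv => by
        rw [LinearMap.mem_ker] at hv ⊢; rw [hb, hv, map_zero]) }
  have hc₁ := LinearMap.IsIdempotentElem.isCompl (f := e₁) (LinearMap.ext h₁)
  have hc₂ := LinearMap.IsIdempotentElem.isCompl (f := e₂) (LinearMap.ext h₂)
  have hiso : (A.prod B).IsIso M :=
    ⟨Submodule.prodEquivOfIsCompl _ _ hc₁, Submodule.prodEquivOfIsCompl _ _ hc₂,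
      fun v => (map_add M.a (v.1 : M.V₂) (v.2 : M.V₂)).symm,
      fun v => (map_add M.b (v.1 : M.V₂) (v.2 : M.V₂)).symm⟩
  rcases h.2 A B hiso.symm with ⟨s₁, s₂⟩ | ⟨s₁, s₂⟩
  · left
    exact ⟨fun v => congrArg Subtype.val (@Subsingleton.elim _ s₁ ⟨e₁ v, v, rfl⟩ 0),
      fun v => congrArg Subtype.val (@Subsingleton.elim _ s₂ ⟨e₂ v, v, rfl⟩ 0)⟩
  · right
    constructor
    · intro v
      have := congrArg Subtype.val (@Subsingleton.elim _ s₁ ⟨e₁ v - v, by simp [h₁]⟩ 0)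
      exact sub_eq_zero.1 this
    · intro v
      have := congrArg Subtype.val (@Subsingleton.elim _ s₂ ⟨e₂ v - v, by simp [h₂]⟩ 0)
      exact sub_eq_zero.1 this

theorem TrivialIdempotents.indecomposable {M : KroneckerModule k} (h : M.TrivialIdempotents)
    (h0 : ¬ M.IsZero) : M.Indecomposable := by
  refine ⟨h0, ?_⟩
  rintro A B ⟨(f₁ : M.V₁ ≃ₗ[k] A.V₁ × B.V₁), (f₂ : M.V₂ ≃ₗ[k] A.V₂ × B.V₂), ha, hb⟩
  replace ha : ∀ v, f₁ (M.a v) = (A.a (f₂ v).1, B.a (f₂ v).2) := ha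
  replace hb : ∀ v, f₁ (M.b v) = (A.b (f₂ v).1, B.b (f₂ v).2) := hb
  have := h (f₁.symm.toLinearMap ∘ₗ LinearMap.inl k _ _ ∘ₗ LinearMap.fst k A.V₁ B.V₁ ∘ₗ f₁)
    (f₂.symm.toLinearMap ∘ₗ LinearMap.inl k _ _ ∘ₗ LinearMap.fst k A.V₂ B.V₂ ∘ₗ f₂)
    (fun v => ?_) (fun v => ?_) (fun v => ?_) (fun v => ?_)
  · rcases this with ⟨h₁, h₂⟩ | ⟨h₁, h₂⟩
    · left
      constructor
      · refine subsingleton_of_forall_eq 0 fun x => ?_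
        have := h₁ (f₁.symm (x, 0))
        simpa using this
      · refine subsingleton_of_forall_eq 0 fun x => ?_
        have := h₂ (f₂.symm (x, 0))
        simpa using this
    · right
      constructor
      · refine subsingleton_of_forall_eq 0 fun x => ?_
        have := h₁ (f₁.symm (0, x))
        simpa [eq_comm] using this
      · refine subsingleton_of_forall_eq 0 fun x => ?_
        have := h₂ (f₂.symm (0, x))
        simpa [eq_comm] using this
  · apply f₁.injective
    simp [ha]
  · apply f₁.injective
    simp [hb]
  · simp
  · simp

theorem TrivialIdempotents.swap {M : KroneckerModule k} (h : M.TrivialIdempotents) :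
    M.swap.TrivialIdempotents :=
  fun e₁ e₂ ha hb => h e₁ e₂ hb ha

theorem Indecomposable.swap {M : KroneckerModule k} (h : M.Indecomposable) :
    M.swap.Indecomposable :=
  h.trivialIdempotents.swap.indecomposable h.1

end KroneckerModule

/-! ### Splitting off a summand on which `b` is onto -/

section Splitting

variable {k Q V W : Type*} [Field k] [AddCommGroup Q] [Module k Q] [AddCommGroup V] [Module k V]
  [AddCommGroup W] [Module k W]

theorem exists_retraction (N : Submodule k V) :
    ∃ ρ : V →ₗ[k] V, (∀ v, ρ v ∈ N) ∧ ∀ v ∈ N, ρ v = v := by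
  obtain ⟨g, hg⟩ := N.subtype.exists_leftInverse_of_injective N.ker_subtype
  exact ⟨N.subtype ∘ₗ g, fun v => (g v).2,
    fun v hv => congrArg Subtype.val (LinearMap.congr_fun hg ⟨v, hv⟩)⟩

/-- The increasing chain `0 ⊆ a⁻¹(b 0) ⊆ a⁻¹(b a⁻¹(b 0)) ⊆ ⋯`. -/
def relChain (a b : V →ₗ[k] W) : ℕ → Submodule k V
  | 0 => ⊥
  | i + 1 => ((relChain a b i).map b).comap a

theorem relChain_le_succ (a b : V →ₗ[k] W) (i : ℕ) : relChain a b i ≤ relChain a b (i + 1) := by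
  induction i with
  | zero => exact bot_le
  | succ i ih => exact Submodule.comap_mono (Submodule.map_mono ih)

/-- Lift `γ` through `b` to `ψ`. The error `a ∘ ψ ∘ c` lies in the image under `b` of the previous
term of the chain, so induction removes it, and the chain ends at zero. -/
theorem exists_solution_relChain (a b : V →ₗ[k] W) (c : Q →ₗ[k] Q) (i : ℕ) (γ : Q →ₗ[k] W)
    (hγ : ∀ q, γ q ∈ (relChain a b i).map b) :
    ∃ φ : Q →ₗ[k] V, (∀ q, φ q ∈ relChain a b i) ∧ ∀ q, b (φ q) - a (φ (c q)) = γ q := by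
  induction i generalizing γ with
  | zero =>
    refine ⟨0, fun q => Submodule.zero_mem _, fun q => ?_⟩
    obtain ⟨x, hx, hq⟩ := hγ q
    rw [← hq, (Submodule.mem_bot k).1 hx]
    simp
  | succ i ih =>
    obtain ⟨ψ, hψ⟩ := Module.projective_lifting_property (b.submoduleMap (relChain a b (i + 1)))
      (γ.codRestrict _ hγ) (b.submoduleMap_surjective _)
    have hψ' : ∀ q, b (ψ q) = γ q := fun q => congrArg Subtype.val (LinearMap.congr_fun hψ q)
    obtain ⟨φ, hφ, hφ'⟩ := ih (a ∘ₗ Submodule.subtype _ ∘ₗ ψ ∘ₗ c) (fun q => (ψ (c q)).2)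
    refine ⟨Submodule.subtype _ ∘ₗ ψ + φ,
      fun q => Submodule.add_mem _ (ψ q).2 (relChain_le_succ a b i (hφ q)), fun q => ?_⟩
    have := hφ' q
    simp only [LinearMap.comp_apply, Submodule.subtype_apply, LinearMap.add_apply, map_add] at this ⊢
    rw [hψ', ← this]
    abel

theorem exists_relChain_stable [Module.Finite k V] (a b : V →ₗ[k] W) :
    ∃ s, relChain a b (s + 1) = relChain a b s := by
  obtain ⟨s, hs⟩ := WellFoundedGT.monotone_chain_condition
    (⟨relChain a b, monotone_nat_of_le_succ (relChain_le_succ a b)⟩ : ℕ →o Submodule k V)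
  exact ⟨s, (hs (s + 1) s.le_succ).symm⟩

end Splitting

namespace KroneckerModule

universe u

variable {k : Type u} [Field k]

/-- Let `K` be the stable term of the chain, so that `K` is the preimage under `a` of `b K`. On the
submodule `(b K, K)` the map `b` is onto, and on the quotient `a` is injective. The extension
splits, so one of the two vanishes. -/
theorem TrivialIdempotents.injective_a_or_surjective_b {M : KroneckerModule k}
    (h : M.TrivialIdempotents) : Function.Injective M.a ∨ Function.Surjective M.b := by
  obtain ⟨s, hs⟩ := exists_relChain_stable M.a M.b
  set K := relChain M.a M.b s with hK
  have hmem : ∀ v, M.a v ∈ K.map M.b ↔ v ∈ K := fun v => by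
    conv_rhs => rw [← hs]
    rfl
  obtain ⟨ρ₁, hρ₁, hρ₁'⟩ := exists_retraction (K.map M.b)
  obtain ⟨ρ₂, hρ₂, hρ₂'⟩ := exists_retraction K
  have hKa : K ≤ (K.map M.b).comap M.a := fun v hv => (hmem v).2 hv
  have hKb : K ≤ (K.map M.b).comap M.b := Submodule.le_comap_map _ _
  obtain ⟨r, hr⟩ := (K.mapQ (K.map M.b) M.a hKa).exists_leftInverse_of_injective (by
    rw [Submodule.ker_mapQ]
    rw [eq_bot_iff, Submodule.map_le_iff_le_comap]
    intro v hv
    simpa using (hmem v).1 hv)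
  have hra : ∀ v, r ((K.map M.b).mkQ (M.a v)) = K.mkQ v := fun v =>
    LinearMap.congr_fun hr (K.mkQ v)
  set c := r ∘ₗ K.mapQ (K.map M.b) M.b hKb with hc
  have hcb : ∀ v, r ((K.map M.b).mkQ (M.b v)) = c (K.mkQ v) := fun v => rfl
  -- `α` and `β` measure the failure of the linear retractions to commute with `a` and `b`; both
  -- factor through the quotient by `K`.
  let α := K.liftQ (M.a ∘ₗ ρ₂ - ρ₁ ∘ₗ M.a) (fun v hv => by
    simp [hρ₂' v hv, hρ₁' _ ((hmem v).2 hv)])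
  let β := K.liftQ (M.b ∘ₗ ρ₂ - ρ₁ ∘ₗ M.b) (fun v hv => by
    simp [hρ₂' v hv, hρ₁' _ (Submodule.mem_map_of_mem hv)])
  have hα : ∀ v, α (K.mkQ v) = M.a (ρ₂ v) - ρ₁ (M.a v) := fun v => rfl
  have hβ : ∀ v, β (K.mkQ v) = M.b (ρ₂ v) - ρ₁ (M.b v) := fun v => rfl
  have hαm : ∀ q, α q ∈ K.map M.b := fun q => by
    obtain ⟨v, rfl⟩ := K.mkQ_surjective q
    rw [hα]
    exact Submodule.sub_mem _ ((hmem _).2 (hρ₂ v)) (hρ₁ _)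
  have hβm : ∀ q, β q ∈ K.map M.b := fun q => by
    obtain ⟨v, rfl⟩ := K.mkQ_surjective q
    rw [hβ]
    exact Submodule.sub_mem _ (Submodule.mem_map_of_mem (hρ₂ v)) (hρ₁ _)
  -- Correcting `ρ₂` by `φ` forces the correction of `ρ₁` on the image of `a`, and `r` extends it.
  -- Compatibility with `b` is then exactly this equation for `φ`.
  obtain ⟨φ, hφ, hφ'⟩ := exists_solution_relChain M.a M.b c s (α ∘ₗ c - β)
    (fun q => Submodule.sub_mem _ (hαm _) (hβm _))
  set π₁ := (K.map M.b).mkQ with hπ₁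
  set π₂ := K.mkQ with hπ₂
  have hπ₁0 : ∀ v ∈ K.map M.b, π₁ v = 0 := fun v hv => by simpa [hπ₁] using hv
  have hπ₂0 : ∀ v ∈ K, π₂ v = 0 := fun v hv => by simpa [hπ₂] using hv
  have h₁m : ∀ v, (ρ₁ + (α + M.a ∘ₗ φ) ∘ₗ r ∘ₗ π₁) v ∈ K.map M.b := fun v =>
    Submodule.add_mem _ (hρ₁ v) (Submodule.add_mem _ (hαm _) ((hmem _).2 (hφ _)))
  have h₁i : ∀ v ∈ K.map M.b, (ρ₁ + (α + M.a ∘ₗ φ) ∘ₗ r ∘ₗ π₁) v = v := fun v hv => by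
    simp [hρ₁' v hv, hπ₁0 v hv]
  have h₂m : ∀ v, (ρ₂ + φ ∘ₗ π₂) v ∈ K := fun v => Submodule.add_mem _ (hρ₂ v) (hφ _)
  have h₂i : ∀ v ∈ K, (ρ₂ + φ ∘ₗ π₂) v = v := fun v hv => by
    simp [hρ₂' v hv, hπ₂0 v hv]
  have hea : ∀ v, (ρ₁ + (α + M.a ∘ₗ φ) ∘ₗ r ∘ₗ π₁) (M.a v) = M.a ((ρ₂ + φ ∘ₗ π₂) v) := by
    intro v
    simp only [LinearMap.add_apply, LinearMap.comp_apply, hra, hα, map_add]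
    abel
  have heb : ∀ v, (ρ₁ + (α + M.a ∘ₗ φ) ∘ₗ r ∘ₗ π₁) (M.b v) = M.b ((ρ₂ + φ ∘ₗ π₂) v) := by
    intro v
    have := hφ' (π₂ v)
    simp only [LinearMap.sub_apply, LinearMap.comp_apply, hβ] at this
    simp only [LinearMap.add_apply, LinearMap.comp_apply, hcb, map_add]
    rw [sub_eq_sub_iff_add_eq_add] at this
    rw [← sub_eq_zero] at this ⊢
    rw [← neg_eq_zero, ← this]
    abel
  rcases h _ _ hea heb (fun v => h₁i _ (h₁m v)) (fun v => h₂i _ (h₂m v)) with ⟨-, e⟩ | ⟨e, -⟩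
  · left
    rw [injective_iff_map_eq_zero]
    intro v hv
    rw [← h₂i v ((hmem v).1 (hv ▸ Submodule.zero_mem _)), e]
  · right
    intro v
    obtain ⟨w, -, hw⟩ := e v ▸ h₁m v
    exact ⟨w, hw⟩

/-! ### Reflection and the preinjective modules -/

theorem I_a_apply (n : ℕ) (v : Fin (n + 1) → k) :
    (Matrix.toLin' (upperBlock k n).transpose v : Fin n → k) = fun i => v i.castSucc := by
  ext i
  simp [upperBlock, Matrix.mulVec, dotProduct]

theorem I_b_apply (n : ℕ) (v : Fin (n + 1) → k) :
    (Matrix.toLin' (lowerBlock k n).transpose v : Fin n → k) = fun i => v i.succ := by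
  ext i
  simp [lowerBlock, Matrix.mulVec, dotProduct]

/-- A line killed by both maps is a direct summand, hence the whole module. -/
theorem TrivialIdempotents.isIso_I_zero {M : KroneckerModule k} (h : M.TrivialIdempotents)
    {v : M.V₂} (hv : v ≠ 0) (ha : M.a v = 0) (hb : M.b v = 0) : M.IsIso (I k 0) := by
  obtain ⟨ρ, hρ, hρ'⟩ := exists_retraction (k ∙ v)
  have hM : ∀ w, M.a (ρ w) = 0 ∧ M.b (ρ w) = 0 := fun w => by
    obtain ⟨c, hc⟩ := Submodule.mem_span_singleton.1 (hρ w)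
    simp [← hc, ha, hb]
  rcases h 0 ρ (fun w => by simp [hM]) (fun w => by simp [hM]) (fun w => rfl)
    (fun w => hρ' _ (hρ w)) with ⟨-, e⟩ | ⟨e₁, e₂⟩
  · exact absurd ((hρ' v (Submodule.mem_span_singleton_self v)).symm.trans (e v)) hv
  · have s₁ : Subsingleton M.V₁ := subsingleton_of_forall_eq 0 fun x => (e₁ x).symm
    have d₂ : finrank k M.V₂ = finrank k (Fin 1 → k) := by
      rw [← finrank_top, ← (eq_top_iff.2 fun w _ => e₂ w ▸ hρ w : k ∙ v = ⊤),
        finrank_span_singleton hv, finrank_fin_fun]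
    have d₁ : finrank k M.V₁ = finrank k (Fin 0 → k) := by
      rw [finrank_zero_of_subsingleton, finrank_fin_fun]
    exact ⟨LinearEquiv.ofFinrankEq _ _ d₁, LinearEquiv.ofFinrankEq _ _ d₂,
      fun w => funext fun i => i.elim0, fun w => funext fun i => i.elim0⟩

/-- The space at the sink of the reflection of `M`. -/
abbrev ReflectionSpace (M : KroneckerModule k) : Type u :=
  (M.V₁ × M.V₁) ⧸ LinearMap.range (M.a.prod M.b)

/-- The first structure map of the reflection of `M`. -/
def reflectionA (M : KroneckerModule k) : M.V₁ →ₗ[k] M.ReflectionSpace :=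
  (LinearMap.range (M.a.prod M.b)).mkQ ∘ₗ LinearMap.inr k _ _

/-- The second structure map of the reflection of `M`. -/
def reflectionB (M : KroneckerModule k) : M.V₁ →ₗ[k] M.ReflectionSpace :=
  -((LinearMap.range (M.a.prod M.b)).mkQ ∘ₗ LinearMap.inl k _ _)

/-- The reflection of `M` at the source of the Kronecker quiver. -/
def reflection (M : KroneckerModule k) : KroneckerModule k where
  V₁ := M.ReflectionSpace
  V₂ := M.V₁
  a := M.reflectionA
  b := M.reflectionB

theorem reflection_sub_apply (M : KroneckerModule k) (x y : M.V₁) :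
    M.reflectionA y - M.reflectionB x = (LinearMap.range (M.a.prod M.b)).mkQ (x, y) := by
  have h : ((x, y) : M.V₁ × M.V₁) = (0, y) + (x, 0) := by simp
  rw [h, map_add]
  simp [reflectionA, reflectionB]

theorem reflection_sub_eq_zero_iff (M : KroneckerModule k) (x y : M.V₁) :
    M.reflectionA y - M.reflectionB x = 0 ↔ ∃ v, M.a v = x ∧ M.b v = y := by
  rw [reflection_sub_apply, Submodule.mkQ_apply, Submodule.Quotient.mk_eq_zero,
    LinearMap.mem_range]
  simp [Prod.ext_iff]

theorem exists_reflection_sub_eq (M : KroneckerModule k) (w : M.ReflectionSpace) :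
    ∃ x y : M.V₁, M.reflectionA y - M.reflectionB x = w := by
  obtain ⟨⟨x, y⟩, rfl⟩ := Submodule.mkQ_surjective (LinearMap.range (M.a.prod M.b)) w
  exact ⟨x, y, reflection_sub_apply M x y⟩

/-- When `(a, b)` is injective, `V₂` is recovered as the pairs `(x, y)` with `reflectionA y =
reflectionB x`, so endomorphisms of the reflection come from `M`. -/
theorem TrivialIdempotents.reflection {M : KroneckerModule k} (h : M.TrivialIdempotents)
    (hM : Function.Injective (M.a.prod M.b)) : M.reflection.TrivialIdempotents := by
  intro (e₁ : M.ReflectionSpace →ₗ[k] M.ReflectionSpace) (e₂ : M.V₁ →ₗ[k] M.V₁) ha hb h₁ h₂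
  replace ha : ∀ v, e₁ (M.reflectionA v) = M.reflectionA (e₂ v) := ha
  replace hb : ∀ v, e₁ (M.reflectionB v) = M.reflectionB (e₂ v) := hb
  replace h₂ : ∀ v, e₂ (e₂ v) = e₂ v := h₂
  obtain ⟨g, hg⟩ := (M.a.prod M.b).exists_leftInverse_of_injective (LinearMap.ker_eq_bot.2 hM)
  have hg' : ∀ v, g (M.a v, M.b v) = v := LinearMap.congr_fun hg
  have key : ∀ v, ∃ w, M.a w = e₂ (M.a v) ∧ M.b w = e₂ (M.b v) := fun v => by
    rw [← reflection_sub_eq_zero_iff]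
    have := (M.reflection_sub_eq_zero_iff (M.a v) (M.b v)).2 ⟨v, rfl, rfl⟩
    have h' := congrArg e₁ this
    rw [map_sub, ha, hb, map_zero] at h'
    exact h'
  -- `e₂` applied to both entries preserves the image of `(a, b)`; `e` is the map so induced on
  -- `V₂`.
  let e : M.V₂ →ₗ[k] M.V₂ := g ∘ₗ (e₂ ∘ₗ M.a).prod (e₂ ∘ₗ M.b)
  have hea : ∀ v, M.a (e v) = e₂ (M.a v) ∧ M.b (e v) = e₂ (M.b v) := fun v => by
    obtain ⟨w, hw⟩ := key v
    have : e v = w := by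
      rw [← hg' w, hw.1, hw.2]
      rfl
    rwa [this]
  have hee : ∀ v, e (e v) = e v := fun v => hM (Prod.ext
    (by simp [hea, h₂]) (by simp [hea, h₂]))
  rcases h e₂ e (fun v => (hea v).1.symm) (fun v => (hea v).2.symm) h₂ hee with ⟨h', -⟩ | ⟨h', -⟩
  · have h₀ : ∀ w : M.ReflectionSpace, e₁ w = 0 := fun w => by
      obtain ⟨x, y, rfl⟩ := M.exists_reflection_sub_eq w
      rw [map_sub, ha, hb, h', h', map_zero, map_zero, sub_zero]
    exact Or.inl ⟨h₀, h'⟩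
  · have h₀ : ∀ w : M.ReflectionSpace, e₁ w = w := fun w => by
      obtain ⟨x, y, rfl⟩ := M.exists_reflection_sub_eq w
      rw [map_sub, ha, hb, h', h']
    exact Or.inr ⟨h₀, h'⟩

theorem isIso_I_succ_of_reflection {M : KroneckerModule k}
    (hM : Function.Injective (M.a.prod M.b)) {j : ℕ} (h : M.reflection.IsIso (I k j)) :
    M.IsIso (I k (j + 1)) := by
  obtain ⟨(f₁ : M.ReflectionSpace ≃ₗ[k] (Fin j → k)), (f₂ : M.V₁ ≃ₗ[k] (Fin (j + 1) → k)),
    ha, hb⟩ := h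
  replace ha : ∀ x, f₁ (M.reflectionA x) = fun i => f₂ x i.castSucc :=
    fun x => (ha x).trans (I_a_apply j _)
  replace hb : ∀ x, f₁ (M.reflectionB x) = fun i => f₂ x i.succ :=
    fun x => (hb x).trans (I_b_apply j _)
  have key : ∀ x y, (∃ v, M.a v = x ∧ M.b v = y) ↔ ∀ i : Fin j, f₂ y i.castSucc = f₂ x i.succ :=
    fun x y => by
      rw [← reflection_sub_eq_zero_iff, ← f₁.map_eq_zero_iff, map_sub, ha, hb, sub_eq_zero,
        funext_iff]
  -- By `key`, the coordinates of `a v` and `b v` overlap as two windows of one vector of length `j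
  -- + 2`; `e v` is that vector.
  let e : M.V₂ →ₗ[k] (Fin (j + 2) → k) :=
    { toFun := fun v => Fin.cons (f₂ (M.a v) 0) (f₂ (M.b v))
      map_add' := fun v w => by
        ext i
        refine Fin.cases ?_ (fun i => ?_) i <;> simp
      map_smul' := fun c v => by
        ext i
        refine Fin.cases ?_ (fun i => ?_) i <;> simp }
  have eb : ∀ v (i : Fin (j + 1)), e v i.succ = f₂ (M.b v) i := fun v i => rfl
  have ea : ∀ v (i : Fin (j + 1)), e v i.castSucc = f₂ (M.a v) i := fun v i => by
    refine Fin.cases rfl (fun i => ?_) i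
    rw [← Fin.succ_castSucc, eb]
    exact (key (M.a v) (M.b v)).1 ⟨v, rfl, rfl⟩ i
  have hinj : Function.Injective e := fun v w hvw => hM (Prod.ext
    (f₂.injective (funext fun i => (ea v i).symm.trans (hvw ▸ ea w i)))
    (f₂.injective (funext fun i => (eb v i).symm.trans (hvw ▸ eb w i))))
  have hsurj : Function.Surjective e := fun r => by
    obtain ⟨v, h₁, h₂⟩ := (key (f₂.symm fun i => r i.castSucc) (f₂.symm fun i => r i.succ)).2
      (fun i => by simp)
    refine ⟨v, funext fun i => Fin.cases ?_ (fun i => ?_) i⟩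
    · change f₂ (M.a v) 0 = _
      simp [h₁]
    · rw [eb, h₂, LinearEquiv.apply_symm_apply]
  refine ⟨f₂, LinearEquiv.ofBijective e ⟨hinj, hsurj⟩, fun v => ?_, fun v => ?_⟩
  · exact (funext fun i => (ea v i).symm).trans (I_a_apply (j + 1) (e v)).symm
  · exact (funext fun i => (eb v i).symm).trans (I_b_apply (j + 1) (e v)).symm

/-- Reflection sends dimensions `(d₁, d₂)` to `(2d₁ - d₂, d₁)`, which preserves `d₁ < d₂` and lowers
`d₁`. The descent stops when `a` and `b` have a common kernel vector. -/
theorem TrivialIdempotents.exists_isIso_I {M : KroneckerModule k} (h : M.TrivialIdempotents)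
    (hd : finrank k M.V₁ < finrank k M.V₂) : ∃ n, M.IsIso (I k n) := by
  induction hn : finrank k M.V₁ using Nat.strong_induction_on generalizing M with
  | _ n ih =>
    by_cases hM : Function.Injective (M.a.prod M.b)
    · have h₁ : finrank k M.ReflectionSpace + _ = _ :=
        Submodule.finrank_quotient_add_finrank (LinearMap.range (M.a.prod M.b))
      rw [LinearMap.finrank_range_of_inj hM, finrank_prod] at h₁
      have h₂ : finrank k M.reflection.V₁ < finrank k M.V₁ := by
        change finrank k M.ReflectionSpace < _
        omega
      obtain ⟨j, hj⟩ := ih _ (hn ▸ h₂) (h.reflection hM) h₂ rfl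
      exact ⟨j + 1, isIso_I_succ_of_reflection hM hj⟩
    · rw [injective_iff_map_eq_zero] at hM
      push Not at hM
      obtain ⟨v, hv, hv0⟩ := hM
      exact ⟨0, h.isIso_I_zero hv0 (congrArg Prod.fst hv) (congrArg Prod.snd hv)⟩

end KroneckerModule

/-! ### Modules in the tubes, and recognising them -/

section PolynomialModule

variable {k W : Type*} [Field k] [AddCommGroup W] [Module k W] [Module k[X] W]
  [IsScalarTower k k[X] W]

theorem Polynomial.map_eq_smul_of_map_X_mul (e : k[X] →ₗ[k] W)
    (h : ∀ q, e (X * q) = (X : k[X]) • e q) (q : k[X]) : e q = q • e 1 := by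
  induction q using Polynomial.induction_on with
  | C a => rw [← mul_one (C a), ← smul_eq_C_mul, map_smul, smul_assoc, one_smul]
  | add p q hp hq => rw [map_add, hp, hq, add_smul]
  | monomial n a ih =>
    rw [pow_succ', mul_left_comm, h, ih, ← mul_smul]

end PolynomialModule

namespace KroneckerModule

universe u

variable {k : Type u} [Field k]

/-- A generator of a maximal ideal of `k[X]`. -/
noncomputable def generator (𝔪 : MaximalSpectrum k[X]) : k[X] :=
  Submodule.IsPrincipal.generator 𝔪.asIdeal

theorem span_generator (𝔪 : MaximalSpectrum k[X]) : Ideal.span {generator 𝔪} = 𝔪.asIdeal :=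
  Ideal.span_singleton_generator _

theorem prime_generator (𝔪 : MaximalSpectrum k[X]) : Prime (generator 𝔪) :=
  haveI := 𝔪.isMaximal.isPrime
  Submodule.IsPrincipal.prime_generator_of_isPrime _ (maximal_ne_bot 𝔪)

theorem mem_pow_iff (𝔪 : MaximalSpectrum k[X]) (t : ℕ) (q : k[X]) :
    q ∈ 𝔪.asIdeal ^ t ↔ generator 𝔪 ^ t ∣ q := by
  rw [← span_generator, Ideal.span_singleton_pow, Ideal.mem_span_singleton]

theorem mem_pow_of_mul_mem_pow {𝔪 : MaximalSpectrum k[X]} {t : ℕ} {p q : k[X]}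
    (hp : p ∉ 𝔪.asIdeal) (h : p * q ∈ 𝔪.asIdeal ^ t) : q ∈ 𝔪.asIdeal ^ t := by
  rw [mem_pow_iff] at h ⊢
  refine (prime_generator 𝔪).pow_dvd_of_dvd_mul_left t (fun hd => hp ?_) h
  rwa [← pow_one 𝔪.asIdeal, mem_pow_iff, pow_one]

/-- The maximal ideal of `k[X]` generated by `X`. -/
noncomputable def originIdeal (k : Type u) [Field k] : MaximalSpectrum k[X] :=
  ⟨Ideal.span {X}, PrincipalIdealRing.isMaximal_of_irreducible irreducible_X⟩

theorem eq_originIdeal {𝔪 : MaximalSpectrum k[X]} (h : X ∈ 𝔪.asIdeal) : 𝔪 = originIdeal k :=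
  MaximalSpectrum.ext ((originIdeal k).isMaximal.eq_of_le 𝔪.isMaximal.ne_top
    ((Ideal.span_singleton_le_iff_mem _).2 h)).symm

theorem R_infty_eq_swap (t : ℕ) :
    R (.infty : ClosedPoint k) t = (R (.affine (originIdeal k)) t).swap :=
  rfl

theorem finrank_R_affine (𝔪 : MaximalSpectrum k[X]) (t : ℕ) :
    finrank k (k[X] ⧸ 𝔪.asIdeal ^ t) = t * (generator 𝔪).natDegree := by
  rw [← span_generator, Ideal.span_singleton_pow, finrank_quotient_span_eq_natDegree,
    natDegree_pow]

/-- An endomorphism is multiplication by some `c`. If it is idempotent, `c * (c - 1)` lies in `𝔪 ^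
t`, while `𝔪` cannot contain both factors. -/
theorem trivialIdempotents_R_affine (𝔪 : MaximalSpectrum k[X]) (t : ℕ) :
    (R (.affine 𝔪) t).TrivialIdempotents := by
  intro (e₁ : k[X] ⧸ 𝔪.asIdeal ^ t →ₗ[k] k[X] ⧸ 𝔪.asIdeal ^ t)
    (e₂ : k[X] ⧸ 𝔪.asIdeal ^ t →ₗ[k] k[X] ⧸ 𝔪.asIdeal ^ t) ha hb h₁ h₂
  replace ha : ∀ v, e₁ v = e₂ v := ha
  replace hb : ∀ v, e₁ (Ideal.Quotient.mk _ X * v) = Ideal.Quotient.mk _ X * e₂ v := hb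
  replace h₁ : ∀ v, e₁ (e₁ v) = e₁ v := h₁
  obtain rfl : e₁ = e₂ := LinearMap.ext ha
  have key : ∀ q : k[X], e₁ (Ideal.Quotient.mk _ q) = q • e₁ 1 := fun q =>
    Polynomial.map_eq_smul_of_map_X_mul
      (e₁ ∘ₗ (Ideal.Quotient.mkₐ k (𝔪.asIdeal ^ t)).toLinearMap)
      (fun q => by simpa [Algebra.smul_def] using hb (Ideal.Quotient.mk _ q)) q
  obtain ⟨c, hc⟩ := Ideal.Quotient.mk_surjective (e₁ 1)
  have hcc : c * (c - 1) ∈ 𝔪.asIdeal ^ t := by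
    have h := h₁ 1
    rw [← hc, key, ← hc, Algebra.smul_def] at h
    rw [← Ideal.Quotient.eq_zero_iff_mem, mul_sub, mul_one, map_sub, map_mul]
    exact sub_eq_zero.2 h
  by_cases hcm : c ∈ 𝔪.asIdeal
  · left
    have hc1 : c - 1 ∉ 𝔪.asIdeal := fun h =>
      𝔪.isMaximal.ne_top ((Ideal.eq_top_iff_one _).2 (by simpa using sub_mem hcm h))
    have h0 := mem_pow_of_mul_mem_pow hc1 (mul_comm c _ ▸ hcc)
    rw [← Ideal.Quotient.eq_zero_iff_mem, hc] at h0
    have : ∀ v, e₁ v = 0 := fun v => by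
      obtain ⟨q, rfl⟩ := Ideal.Quotient.mk_surjective v
      rw [key, h0, smul_zero]
    exact ⟨this, this⟩
  · right
    have h1 := mem_pow_of_mul_mem_pow hcm hcc
    rw [← Ideal.Quotient.eq_zero_iff_mem, map_sub, hc, sub_eq_zero] at h1
    have : ∀ v, e₁ v = v := fun v => by
      obtain ⟨q, rfl⟩ := Ideal.Quotient.mk_surjective v
      rw [key, h1, Algebra.smul_def]
      exact mul_one _
    exact ⟨this, this⟩

theorem finrank_R_eq (x : ClosedPoint k) (t : ℕ) :
    finrank k (R x t).V₁ = finrank k (R x t).V₂ := by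
  cases x <;> rfl

theorem not_isZero_R_affine (𝔪 : MaximalSpectrum k[X]) {t : ℕ} (ht : 1 ≤ t) :
    ¬ (R (.affine 𝔪) t).IsZero := by
  rintro ⟨h, -⟩
  replace h : Subsingleton (k[X] ⧸ 𝔪.asIdeal ^ t) := h
  rw [Ideal.Quotient.subsingleton_iff] at h
  exact 𝔪.isMaximal.ne_top (eq_top_iff.2 (h ▸ Ideal.pow_le_self (by omega)))

theorem indecomposable_R (x : ClosedPoint k) {t : ℕ} (ht : 1 ≤ t) : (R x t).Indecomposable := by
  cases x with
  | affine 𝔪 => exact (trivialIdempotents_R_affine 𝔪 t).indecomposable (not_isZero_R_affine 𝔪 ht)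
  | infty =>
    rw [R_infty_eq_swap]
    exact (trivialIdempotents_R_affine _ t).swap.indecomposable (not_isZero_R_affine _ ht)

theorem isRegularIndecomposable_R (x : ClosedPoint k) {t : ℕ} (ht : 1 ≤ t) :
    (R x t).IsRegularIndecomposable := by
  refine ⟨indecomposable_R x ht, fun n h => ?_, fun n h => ?_⟩
  · have := finrank_R_eq x t
    rw [h.finrank₁, h.finrank₂] at this
    change finrank k (Fin (n + 1) → k) = finrank k (Fin n → k) at this
    simp at this
  · have := finrank_R_eq x t
    rw [h.finrank₁, h.finrank₂] at this
    change finrank k (Fin n → k) = finrank k (Fin (n + 1) → k) at this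
    simp at this

/-- Identifying `V₂` with `V₁` through `a` makes `V₁` a torsion `k[X]`-module, with `X` acting as `b
∘ a⁻¹`. The projection onto a nonzero primary cyclic summand is an idempotent, hence the identity.
-/
theorem TrivialIdempotents.exists_isIso_R_affine {M : KroneckerModule k}
    (h : M.TrivialIdempotents) (h0 : ¬ M.IsZero) (ha : Function.Bijective M.a) :
    ∃ (𝔪 : MaximalSpectrum k[X]) (t : ℕ), 1 ≤ t ∧ M.IsIso (R (.affine 𝔪) t) := by
  let α : M.V₂ ≃ₗ[k] M.V₁ := LinearEquiv.ofBijective M.a ha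
  have hα : ∀ v, α v = M.a v := fun v => rfl
  let T : Module.End k M.V₁ := M.b ∘ₗ α.symm
  have hT : ∀ v, T (M.a v) = M.b v := fun v => by simp [T, ← hα]
  let o := AEval'.of T
  obtain ⟨ι, _, p, hp, e, ⟨Φ⟩⟩ := Module.equiv_directSum_of_isTorsion
    (Module.AEval.isTorsion_of_finiteDimensional k M.V₁ T)
  classical
  have hi : ∃ i, e i ≠ 0 := by
    by_contra! hc
    have hs : ∀ i, Subsingleton (k[X] ⧸ Submodule.span k[X] {p i ^ e i}) := fun i => by
      rw [hc i, pow_zero]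
      exact Ideal.Quotient.subsingleton_iff.2 Ideal.span_singleton_one
    have s₁ : Subsingleton M.V₁ := by
      refine subsingleton_of_forall_eq 0 fun v => ?_
      rw [← o.map_eq_zero_iff, ← Φ.map_eq_zero_iff]
      exact DFinsupp.ext fun i => (hs i).elim _ _
    exact h0 ⟨s₁, α.injective.subsingleton⟩
  obtain ⟨i, hi⟩ := hi
  let 𝔪 : MaximalSpectrum k[X] :=
    ⟨Ideal.span {p i}, PrincipalIdealRing.isMaximal_of_irreducible (hp i)⟩
  have hpow : Submodule.span k[X] {p i ^ e i} = 𝔪.asIdeal ^ e i :=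
    (Ideal.span_singleton_pow _ _).symm
  let lof := DirectSum.lof k[X] ι (fun i => k[X] ⧸ Submodule.span k[X] {p i ^ e i}) i
  let comp := DirectSum.component k[X] ι (fun i => k[X] ⧸ Submodule.span k[X] {p i ^ e i}) i
  have hcl : ∀ x, comp (lof x) = x := fun x => DirectSum.component.lof_self _ _ _
  let E : AEval' T →ₗ[k[X]] AEval' T := Φ.symm.toLinearMap ∘ₗ lof ∘ₗ comp ∘ₗ Φ.toLinearMap
  have hE : ∀ w, E w = Φ.symm (lof (comp (Φ w))) := fun w => rfl
  let e₁ : M.V₁ →ₗ[k] M.V₁ := o.symm.toLinearMap ∘ₗ E.restrictScalars k ∘ₗ o.toLinearMap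
  have he₁ : ∀ v, o (e₁ v) = E (o v) := fun v => by simp [e₁]
  have hX : ∀ v, (X : k[X]) • o v = o (T v) := AEval'.X_smul_of T
  have hT₁ : ∀ v, e₁ (T v) = T (e₁ v) := fun v => by
    apply o.injective
    rw [he₁, ← hX, ← hX, map_smul, he₁]
  let e₂ : M.V₂ →ₗ[k] M.V₂ := α.symm.toLinearMap ∘ₗ e₁ ∘ₗ α.toLinearMap
  have he₂ : ∀ v, M.a (e₂ v) = e₁ (M.a v) := fun v => by simp [e₂, ← hα]
  have h₁ : ∀ v, e₁ (e₁ v) = e₁ v := fun v => by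
    apply o.injective
    rw [he₁, he₁, hE, hE, LinearEquiv.apply_symm_apply, hcl]
  rcases h e₁ e₂ (fun v => (he₂ v).symm) (fun v => by rw [← hT, ← hT, he₂, hT₁]) h₁
    (fun v => ha.1 (by rw [he₂, he₂, h₁])) with ⟨h', -⟩ | ⟨h', -⟩
  -- The class of `1` in the chosen summand is nonzero, since its exponent is positive.
  · exfalso
    have h1 : comp (Φ (o (e₁ (o.symm (Φ.symm (lof (Submodule.Quotient.mk 1))))))) = 0 := by
      rw [h', map_zero, map_zero, map_zero]
    rw [he₁, hE] at h1
    simp only [LinearEquiv.apply_symm_apply, hcl] at h1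
    rw [Submodule.Quotient.mk_eq_zero, hpow] at h1
    exact 𝔪.isMaximal.ne_top ((Ideal.eq_top_iff_one _).2 (Ideal.pow_le_self hi h1))
  · have hinv : ∀ w, Φ.symm (lof (comp (Φ w))) = w := fun w => by
      obtain ⟨v, rfl⟩ := o.surjective w
      rw [← hE, ← he₁, h']
    let Ψ₀ : AEval' T ≃ₗ[k[X]] k[X] ⧸ Submodule.span k[X] {p i ^ e i} :=
      { toLinearMap := comp ∘ₗ Φ.toLinearMap
        invFun := fun x => Φ.symm (lof x)
        left_inv := hinv
        right_inv := fun x => by simp [hcl] }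
    let Ψ : AEval' T ≃ₗ[k[X]] k[X] ⧸ 𝔪.asIdeal ^ e i :=
      Ψ₀.trans (Submodule.quotEquivOfEq _ _ hpow)
    let θ : M.V₁ ≃ₗ[k] k[X] ⧸ 𝔪.asIdeal ^ e i := o.trans (Ψ.restrictScalars k)
    refine ⟨𝔪, e i, Nat.one_le_iff_ne_zero.2 hi, θ, α.trans θ, fun v => rfl, fun v => ?_⟩
    change Ψ (o (M.b v)) = Ideal.Quotient.mk _ X * Ψ (o (M.a v))
    rw [← hT, ← hX, map_smul, Algebra.smul_def]
    rfl

/-- With equal dimensions, injective or surjective means bijective. If `a` is not injective, then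
`b` is bijective, and the swapped module lies at a point where `X` is not invertible, that is, at
the origin; swapping back gives infinity. -/
theorem Indecomposable.exists_inTube {M : KroneckerModule k} (h : M.Indecomposable)
    (hd : finrank k M.V₁ = finrank k M.V₂) : ∃ x, InTube x M := by
  by_cases hinj : Function.Injective M.a
  · obtain ⟨𝔪, t, ht, hi⟩ := h.trivialIdempotents.exists_isIso_R_affine h.1
      ⟨hinj, (LinearMap.injective_iff_surjective_of_finrank_eq_finrank hd.symm).1 hinj⟩
    exact ⟨_, t, ht, hi⟩
  · have hs := h.trivialIdempotents.injective_a_or_surjective_b.resolve_left hinj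
    obtain ⟨𝔪, t, ht, hi⟩ := h.swap.trivialIdempotents.exists_isIso_R_affine h.1
      ⟨(LinearMap.injective_iff_surjective_of_finrank_eq_finrank hd.symm).2 hs, hs⟩
    obtain ⟨e₁, e₂, ha, hb⟩ := hi
    obtain rfl : 𝔪 = originIdeal k := by
      refine eq_originIdeal (by_contra fun hX => hinj ?_)
      rw [injective_iff_map_eq_zero]
      intro v hv
      obtain ⟨w, hw⟩ : ∃ w : k[X] ⧸ 𝔪.asIdeal ^ t, w = e₂ v := ⟨_, rfl⟩
      have h0 : Ideal.Quotient.mk (𝔪.asIdeal ^ t) X * w = 0 := by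
        rw [hw]
        exact (hb v).symm.trans ((congrArg e₁ hv).trans (map_zero e₁))
      obtain ⟨q, hq⟩ := Ideal.Quotient.mk_surjective w
      rw [← hq, ← map_mul, Ideal.Quotient.eq_zero_iff_mem] at h0
      have hq0 := mem_pow_of_mul_mem_pow hX h0
      rw [← Ideal.Quotient.eq_zero_iff_mem, hq] at hq0
      exact e₂.map_eq_zero_iff.1 (hw.symm.trans hq0)
    exact ⟨.infty, t, ht, e₁, e₂, hb, ha⟩

end KroneckerModule

/-! ### Polynomials as coefficient vectors, and morphisms out of `P k m` -/

section CoefficientVectors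

variable {k : Type*} [Field k]

/-- The polynomial of degree less than `n` with a given vector of coefficients. -/
noncomputable def toPoly (n : ℕ) : (Fin n → k) →ₗ[k] k[X] :=
  (degreeLT k n).subtype ∘ₗ (degreeLTEquiv k n).symm.toLinearMap

theorem toPoly_apply {n : ℕ} (v : Fin n → k) : toPoly n v = ∑ i : Fin n, monomial (i : ℕ) (v i) :=
  rfl

theorem toPoly_mem {n : ℕ} (v : Fin n → k) : toPoly n v ∈ degreeLT k n :=
  ((degreeLTEquiv k n).symm v).2

theorem toPoly_coeff {n : ℕ} (v : Fin n → k) (i : Fin n) : (toPoly n v).coeff i = v i :=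
  congrFun ((degreeLTEquiv k n).apply_symm_apply v) i

theorem toPoly_injective (n : ℕ) : Function.Injective (toPoly n : (Fin n → k) →ₗ[k] k[X]) :=
  fun v w h => funext fun i => by rw [← toPoly_coeff v, h, toPoly_coeff]

theorem exists_toPoly_eq {n : ℕ} {q : k[X]} (hq : q ∈ degreeLT k n) : ∃ v, toPoly n v = q :=
  ⟨degreeLTEquiv k n ⟨q, hq⟩, by simp [toPoly]⟩

theorem toPoly_single {n : ℕ} (i : Fin n) : toPoly n (Pi.single i (1 : k)) = X ^ (i : ℕ) := by
  rw [toPoly_apply, Finset.sum_eq_single i]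
  · simp [X_pow_eq_monomial]
  · intro j _ hj
    simp [hj]
  · simp

/-- Reversal turns vanishing at the origin into a drop in degree. This is how the local condition at
infinity becomes a degree bound. -/
theorem toPoly_rev_mem_iff {n t : ℕ} (v : Fin n → k) :
    X ^ t ∣ toPoly n (v ∘ Fin.rev) ↔ toPoly n v ∈ degreeLT k (n - t) := by
  rw [X_pow_dvd_iff, mem_degreeLT, degree_lt_iff_coeff_zero]
  constructor
  · intro h j hj
    by_cases hjn : j < n
    · have := h (⟨j, hjn⟩ : Fin n).rev (by simp only [Fin.val_rev]; omega)
      rw [toPoly_coeff, Function.comp_apply, Fin.rev_rev] at this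
      rw [← this]
      exact toPoly_coeff v ⟨j, hjn⟩
    · exact coeff_eq_zero_of_degree_lt ((mem_degreeLT.1 (toPoly_mem v)).trans_le
        (by exact_mod_cast not_lt.1 hjn))
  · intro h j hj
    by_cases hjn : j < n
    · have := h (⟨j, hjn⟩ : Fin n).rev (by simp only [Fin.val_rev]; omega)
      rw [toPoly_coeff] at this
      rw [← this]
      exact toPoly_coeff (v ∘ Fin.rev) ⟨j, hjn⟩
    · exact coeff_eq_zero_of_degree_lt ((mem_degreeLT.1 (toPoly_mem _)).trans_le
        (by exact_mod_cast not_lt.1 hjn))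

end CoefficientVectors

namespace KroneckerModule

universe u

variable {k : Type u} [Field k]

theorem P_a_castSucc (n : ℕ) (v : Fin n → k) (i : Fin n) :
    Matrix.toLin' (upperBlock k n) v i.castSucc = v i := by
  simp [upperBlock, Matrix.mulVec, dotProduct]

theorem P_a_last (n : ℕ) (v : Fin n → k) :
    Matrix.toLin' (upperBlock k n) v (Fin.last n) = 0 := by
  simp [upperBlock, Matrix.mulVec, dotProduct, (Fin.castSucc_lt_last _).ne']

theorem P_b_succ (n : ℕ) (v : Fin n → k) (i : Fin n) :
    Matrix.toLin' (lowerBlock k n) v i.succ = v i := by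
  simp [lowerBlock, Matrix.mulVec, dotProduct]

theorem P_b_zero (n : ℕ) (v : Fin n → k) : Matrix.toLin' (lowerBlock k n) v 0 = 0 := by
  simp [lowerBlock, Matrix.mulVec, dotProduct, (Fin.succ_ne_zero _).symm]

theorem toPoly_upperBlock (n : ℕ) (v : Fin n → k) :
    toPoly (n + 1) (Matrix.toLin' (upperBlock k n) v) = toPoly n v := by
  rw [toPoly_apply, toPoly_apply, Fin.sum_univ_castSucc, P_a_last]
  simp only [P_a_castSucc, Fin.val_castSucc, map_zero, add_zero]

theorem toPoly_lowerBlock (n : ℕ) (v : Fin n → k) :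
    toPoly (n + 1) (Matrix.toLin' (lowerBlock k n) v) = X * toPoly n v := by
  rw [toPoly_apply, toPoly_apply, Fin.sum_univ_succ, P_b_zero, Finset.mul_sum]
  simp only [P_b_succ, Fin.val_succ, map_zero, zero_add, X_mul_monomial]

theorem upperBlock_comp_rev (n : ℕ) (v : Fin n → k) :
    Matrix.toLin' (upperBlock k n) (v ∘ Fin.rev) = Matrix.toLin' (lowerBlock k n) v ∘ Fin.rev := by
  ext i
  refine Fin.lastCases ?_ (fun i => ?_) i
  · rw [P_a_last, Function.comp_apply, Fin.rev_last, P_b_zero]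
  · rw [P_a_castSucc, Function.comp_apply, Function.comp_apply, Fin.rev_castSucc, P_b_succ]

theorem lowerBlock_comp_rev (n : ℕ) (v : Fin n → k) :
    Matrix.toLin' (lowerBlock k n) (v ∘ Fin.rev) = Matrix.toLin' (upperBlock k n) v ∘ Fin.rev := by
  ext i
  refine Fin.cases ?_ (fun i => ?_) i
  · rw [P_b_zero, Function.comp_apply, Fin.rev_zero, P_a_last]
  · rw [P_b_succ, Function.comp_apply, Function.comp_apply, Fin.rev_succ, P_a_castSucc]

/-- A pair of maps from `Pₙ` to a `k[X]`-module which is compatible with the structure maps is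
given by multiplication. -/
theorem map_eq_toPoly_smul {W : Type*} [AddCommGroup W] [Module k W] [Module k[X] W]
    [IsScalarTower k k[X] W] {n : ℕ} (φ₁ : (Fin (n + 1) → k) →ₗ[k] W) (φ₂ : (Fin n → k) →ₗ[k] W)
    (ha : ∀ v, φ₁ (Matrix.toLin' (upperBlock k n) v) = φ₂ v)
    (hb : ∀ v, φ₁ (Matrix.toLin' (lowerBlock k n) v) = (X : k[X]) • φ₂ v) (v : Fin (n + 1) → k) :
    φ₁ v = toPoly (n + 1) v • φ₁ (Pi.single 0 1) := by
  -- Consecutive basis vectors of `V₁` are the images under `a` and `b` of one basis vector of `V₂`,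
  -- so each is `X` times the previous one in `W`.
  have key : ∀ i : Fin (n + 1), φ₁ (Pi.single i 1) = (X : k[X]) ^ (i : ℕ) • φ₁ (Pi.single 0 1) := by
    intro i
    induction i using Fin.induction with
    | zero => rw [Fin.val_zero, pow_zero, one_smul]
    | succ i ih =>
      have h₁ : Matrix.toLin' (lowerBlock k n) (Pi.single i 1) = Pi.single i.succ 1 :=
        toPoly_injective _ (by
          rw [toPoly_lowerBlock, toPoly_single, toPoly_single, Fin.val_succ, pow_succ'])
      have h₂ : Matrix.toLin' (upperBlock k n) (Pi.single i 1) = Pi.single i.castSucc 1 :=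
        toPoly_injective _ (by
          rw [toPoly_upperBlock, toPoly_single, toPoly_single, Fin.val_castSucc])
      rw [← h₁, hb, ← ha, h₂, ih, smul_smul, Fin.val_castSucc, Fin.val_succ, pow_succ']
  have hv : v = ∑ i, v i • Pi.single i (1 : k) := by
    simp_rw [← Pi.single_smul, smul_eq_mul, mul_one]
    exact (Finset.univ_sum_single v).symm
  conv_lhs => rw [hv]
  conv_rhs => rw [hv]
  rw [map_sum, map_sum, Finset.sum_smul]
  exact Finset.sum_congr rfl fun i _ => by
    rw [map_smul, key, map_smul, toPoly_single, smul_assoc]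

/-- A morphism from `Pₘ` to `R_x(t)` at an affine point `x` is given by multiplication. -/
theorem hom_affine_apply {m t : ℕ} {𝔪 : MaximalSpectrum k[X]} (φ : Hom (P k m) (R (.affine 𝔪) t)) :
    ∃ c : k[X], ∀ v : Fin (m + 1) → k, φ.φ₁ v = Ideal.Quotient.mk (𝔪.asIdeal ^ t)
      (toPoly (m + 1) v * c) := by
  let φ₁ : (Fin (m + 1) → k) →ₗ[k] k[X] ⧸ 𝔪.asIdeal ^ t := φ.φ₁
  let φ₂ : (Fin m → k) →ₗ[k] k[X] ⧸ 𝔪.asIdeal ^ t := φ.φ₂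
  obtain ⟨c, hc⟩ := Ideal.Quotient.mk_surjective (φ₁ (Pi.single 0 1))
  refine ⟨c, fun v => (map_eq_toPoly_smul φ₁ φ₂ (LinearMap.congr_fun φ.comm_a)
    (fun v => (LinearMap.congr_fun φ.comm_b v).trans ?_) v).trans ?_⟩
  · rw [Algebra.smul_def]
    rfl
  · rw [← hc, map_mul, Algebra.smul_def]
    rfl

/-- Modulo `𝔪` the joint map is `r ↦ (r * c, r * c')`, whose image lies in a line over the residue
field. Reaching `(1, 0)` forces `c'` into `𝔪`, and then `(0, 1)` is missed. -/
theorem not_jointly_surjective_affine {m t t' : ℕ} {𝔪 : MaximalSpectrum k[X]} (ht : 1 ≤ t)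
    (ht' : 1 ≤ t') (φ : Hom (P k m) (R (.affine 𝔪) t)) (φ' : Hom (P k m) (R (.affine 𝔪) t')) :
    ¬ ∀ y y', ∃ v, φ.φ₁ v = y ∧ φ'.φ₁ v = y' := by
  intro h
  obtain ⟨c, hc⟩ := hom_affine_apply φ
  obtain ⟨c', hc'⟩ := hom_affine_apply φ'
  have key : ∀ p q : k[X], ∃ r : k[X], r * c - p ∈ 𝔪.asIdeal ∧ r * c' - q ∈ 𝔪.asIdeal := by
    intro p q
    obtain ⟨v, h₁, h₂⟩ := h (Ideal.Quotient.mk (𝔪.asIdeal ^ t) p)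
      (Ideal.Quotient.mk (𝔪.asIdeal ^ t') q)
    exact ⟨toPoly (m + 1) v,
      Ideal.pow_le_self (by omega) (Ideal.Quotient.eq.1 ((hc v).symm.trans h₁)),
      Ideal.pow_le_self (by omega) (Ideal.Quotient.eq.1 ((hc' v).symm.trans h₂))⟩
  have h1 : (1 : k[X]) ∉ 𝔪.asIdeal := fun h1 =>
    𝔪.isMaximal.ne_top ((Ideal.eq_top_iff_one _).2 h1)
  obtain ⟨r, hr, hr'⟩ := key 1 0
  obtain ⟨s, -, hs⟩ := key 0 1
  rw [sub_zero] at hr'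
  rcases 𝔪.isMaximal.isPrime.mem_or_mem hr' with h₀ | h₀
  · exact h1 (by simpa using sub_mem (Ideal.mul_mem_right c _ h₀) hr)
  · exact h1 (by simpa using sub_mem (Ideal.mul_mem_left _ s h₀) hs)

/-- Reversal of coefficients. -/
def reverseVec (k : Type u) [Field k] (n : ℕ) : (Fin n → k) →ₗ[k] (Fin n → k) :=
  LinearMap.funLeft k k Fin.rev

theorem reverseVec_apply {n : ℕ} (v : Fin n → k) : reverseVec k n v = v ∘ Fin.rev :=
  rfl

theorem reverseVec_reverseVec {n : ℕ} (v : Fin n → k) : reverseVec k n (reverseVec k n v) = v := by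
  ext i
  simp [reverseVec_apply]

/-- A morphism from `Pₘ` to `N`, read as a morphism to `N` with its structure maps interchanged. -/
noncomputable def Hom.reverse {m : ℕ} {N : KroneckerModule k} (φ : Hom (P k m) N) : Hom (P k m) N.swap where
  φ₁ := φ.φ₁ ∘ₗ reverseVec k (m + 1)
  φ₂ := φ.φ₂ ∘ₗ reverseVec k m
  comm_a := LinearMap.ext fun v => (congrArg φ.φ₁ (lowerBlock_comp_rev m v).symm).trans
    (LinearMap.congr_fun φ.comm_b (reverseVec k m v))
  comm_b := LinearMap.ext fun v => (congrArg φ.φ₁ (upperBlock_comp_rev m v).symm).trans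
    (LinearMap.congr_fun φ.comm_a (reverseVec k m v))

theorem not_jointly_surjective {m t t' : ℕ} (x : ClosedPoint k) (ht : 1 ≤ t)
    (ht' : 1 ≤ t') (φ : Hom (P k m) (R x t)) (φ' : Hom (P k m) (R x t')) :
    ¬ ∀ y y', ∃ v, φ.φ₁ v = y ∧ φ'.φ₁ v = y' := by
  cases x with
  | affine 𝔪 => exact not_jointly_surjective_affine ht ht' φ φ'
  | infty =>
    intro h
    refine not_jointly_surjective_affine (𝔪 := originIdeal k) ht ht' φ.reverse φ'.reverse
      fun y y' => ?_
    obtain ⟨v, h₁, h₂⟩ := h y y'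
    exact ⟨reverseVec k (m + 1) v, (congrArg φ.φ₁ (reverseVec_reverseVec v)).trans h₁,
      (congrArg φ'.φ₁ (reverseVec_reverseVec v)).trans h₂⟩

/-- Composition of morphisms. -/
def Hom.comp {L M N : KroneckerModule k} (g : Hom M N) (f : Hom L M) : Hom L N where
  φ₁ := g.φ₁ ∘ₗ f.φ₁
  φ₂ := g.φ₂ ∘ₗ f.φ₂
  comm_a := by rw [LinearMap.comp_assoc, f.comm_a, ← LinearMap.comp_assoc, g.comm_a,
    LinearMap.comp_assoc]
  comm_b := by rw [LinearMap.comp_assoc, f.comm_b, ← LinearMap.comp_assoc, g.comm_b,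
    LinearMap.comp_assoc]

/-- The projection of a direct sum onto a summand. -/
def Hom.proj {r : ℕ} (Y : Fin r → KroneckerModule k) (i : Fin r) : Hom (directSum Y) (Y i) where
  φ₁ := LinearMap.proj i
  φ₂ := LinearMap.proj i
  comm_a := rfl
  comm_b := rfl

theorem IsIso.exists_hom {M N : KroneckerModule k} (h : M.IsIso N) :
    ∃ f : Hom M N, Function.Bijective f.φ₁ ∧ Function.Bijective f.φ₂ := by
  obtain ⟨e₁, e₂, ha, hb⟩ := h
  exact ⟨⟨e₁, e₂, LinearMap.ext ha, LinearMap.ext hb⟩, e₁.bijective, e₂.bijective⟩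

theorem summandsInDistinctTubes_of_surjective {m : ℕ} {M : KroneckerModule k}
    (g : Hom (P k m) M) (hg : Function.Surjective g.φ₁) : M.SummandsInDistinctTubes := by
  rintro r Y - hiso i j hij x x' ⟨t, ht, hi⟩ ⟨t', ht', hj⟩ rfl
  obtain ⟨e, he, -⟩ := hiso.exists_hom
  obtain ⟨p, hp, -⟩ := hi.exists_hom
  obtain ⟨q, hq, -⟩ := hj.exists_hom
  refine not_jointly_surjective x ht ht' (p.comp ((Hom.proj Y i).comp (e.comp g)))
    (q.comp ((Hom.proj Y j).comp (e.comp g))) fun y y' => ?_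
  obtain ⟨z, rfl⟩ := hp.2 y
  obtain ⟨z', rfl⟩ := hq.2 y'
  obtain ⟨w, hw⟩ := he.2 (Function.update (Function.update (0 : ∀ l, (Y l).V₁) i z) j z')
  obtain ⟨v, rfl⟩ := hg w
  refine ⟨v, congrArg p.φ₁ ?_, congrArg q.φ₁ ?_⟩
  · refine (congrFun hw i).trans ?_
    rw [Function.update_of_ne hij, Function.update_self]
  · refine (congrFun hw j).trans ?_
    rw [Function.update_self]

end KroneckerModule

theorem surjective_of_exact_of_finrank {k A B C : Type*} [Field k] [AddCommGroup A] [Module k A]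
    [AddCommGroup B] [Module k B] [AddCommGroup C] [Module k C] [Module.Finite k B]
    [Module.Finite k C] {f : A →ₗ[k] B} {g : B →ₗ[k] C} (hf : Function.Injective f)
    (hfg : Function.Exact f g) (h : finrank k B = finrank k A + finrank k C) :
    Function.Surjective g := by
  have h₁ := LinearMap.finrank_range_add_finrank_ker g
  rw [hfg.linearMap_ker_eq, LinearMap.finrank_range_of_inj hf] at h₁
  exact LinearMap.range_eq_top.1 (Submodule.eq_top_of_finrank_eq (by omega))

/-! ### The cokernel of multiplication by a polynomial -/

namespace KroneckerModule

universe u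

variable {k : Type u} [Field k]

/-- The polynomial whose vanishing locus on the affine line is the given point; it is `1` for the
point at infinity. -/
noncomputable def pointPoly : ClosedPoint k → k[X]
  | .affine 𝔪 => generator 𝔪
  | .infty => 1

/-- The indicator function of the point at infinity. -/
def atInfty : ClosedPoint k → ℕ
  | .affine _ => 0
  | .infty => 1

theorem pointPoly_ne_zero (x : ClosedPoint k) : pointPoly x ≠ 0 := by
  cases x with
  | affine 𝔪 => exact (prime_generator 𝔪).ne_zero
  | infty => exact one_ne_zero

theorem isCoprime_pointPoly {x y : ClosedPoint k} (h : x ≠ y) :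
    IsCoprime (pointPoly x) (pointPoly y) := by
  cases x with
  | infty => exact isCoprime_one_left
  | affine 𝔪 =>
    cases y with
    | infty => exact isCoprime_one_right
    | affine 𝔫 =>
      rw [← Ideal.isCoprime_span_singleton_iff]
      change IsCoprime (Ideal.span {generator 𝔪}) (Ideal.span {generator 𝔫})
      rw [span_generator, span_generator, Ideal.isCoprime_iff_sup_eq]
      exact 𝔪.isMaximal.coprime_of_ne 𝔫.isMaximal
        fun e => h (congrArg ClosedPoint.affine (MaximalSpectrum.ext e))

theorem finrank_R (x : ClosedPoint k) (t : ℕ) :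
    finrank k (R x t).V₁ = t * (pointPoly x).natDegree + atInfty x * t := by
  cases x with
  | affine 𝔪 =>
    rw [atInfty, zero_mul, add_zero]
    exact finrank_R_affine 𝔪 t
  | infty =>
    change finrank k (k[X] ⧸ (Ideal.span {X} : Ideal k[X]) ^ t) = _
    rw [Ideal.span_singleton_pow, finrank_quotient_span_eq_natDegree]
    simp [pointPoly, atInfty]

/-- The morphism from `Pₘ` to `R_x(t)` at an affine point given by reduction of polynomials. -/
noncomputable def homAffine (m : ℕ) (𝔪 : MaximalSpectrum k[X]) (t : ℕ) :
    Hom (P k m) (R (.affine 𝔪) t) where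
  φ₁ := (Ideal.Quotient.mkₐ k (𝔪.asIdeal ^ t)).toLinearMap ∘ₗ toPoly (m + 1)
  φ₂ := (Ideal.Quotient.mkₐ k (𝔪.asIdeal ^ t)).toLinearMap ∘ₗ toPoly m
  comm_a := LinearMap.ext fun v =>
    congrArg (Ideal.Quotient.mk (𝔪.asIdeal ^ t)) (toPoly_upperBlock m v)
  comm_b := LinearMap.ext fun v =>
    (congrArg (Ideal.Quotient.mk (𝔪.asIdeal ^ t)) (toPoly_lowerBlock m v)).trans (map_mul _ _ _)

/-- The canonical morphism from `Pₘ` to `R_x(t)`. -/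
noncomputable def homR (m : ℕ) : ∀ (x : ClosedPoint k) (t : ℕ), Hom (P k m) (R x t)
  | .affine 𝔪, t => homAffine m 𝔪 t
  | .infty, t => (homAffine m (originIdeal k) t).reverse

theorem mk_toPoly_eq_zero_iff (𝔪 : MaximalSpectrum k[X]) (t : ℕ) {n : ℕ} (v : Fin n → k) :
    Ideal.Quotient.mk (𝔪.asIdeal ^ t) (toPoly n v) = 0 ↔
      pointPoly (.affine 𝔪) ^ t ∣ toPoly n v ∧
        toPoly n v ∈ degreeLT k (n - atInfty (.affine 𝔪) * t) := by
  rw [Ideal.Quotient.eq_zero_iff_mem, mem_pow_iff, atInfty, zero_mul, Nat.sub_zero]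
  exact (and_iff_left (toPoly_mem v)).symm

theorem mk_toPoly_rev_eq_zero_iff (t : ℕ) {n : ℕ} (v : Fin n → k) :
    Ideal.Quotient.mk ((originIdeal k).asIdeal ^ t) (toPoly n (reverseVec k n v)) = 0 ↔
      pointPoly (.infty : ClosedPoint k) ^ t ∣ toPoly n v ∧
        toPoly n v ∈ degreeLT k (n - atInfty (.infty : ClosedPoint k) * t) := by
  rw [Ideal.Quotient.eq_zero_iff_mem, atInfty, one_mul, pointPoly, one_pow, originIdeal,
    Ideal.span_singleton_pow, Ideal.mem_span_singleton, reverseVec_apply, toPoly_rev_mem_iff]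
  exact (and_iff_right (one_dvd _)).symm

theorem homR_φ₁_eq_zero_iff (m : ℕ) (x : ClosedPoint k) (t : ℕ) (v : Fin (m + 1) → k) :
    (homR m x t).φ₁ v = 0 ↔ pointPoly x ^ t ∣ toPoly (m + 1) v ∧
      toPoly (m + 1) v ∈ degreeLT k (m + 1 - atInfty x * t) := by
  cases x with
  | affine 𝔪 => exact mk_toPoly_eq_zero_iff 𝔪 t v
  | infty => exact mk_toPoly_rev_eq_zero_iff t v

theorem homR_φ₂_eq_zero_iff (m : ℕ) (x : ClosedPoint k) (t : ℕ) (v : Fin m → k) :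
    (homR m x t).φ₂ v = 0 ↔ pointPoly x ^ t ∣ toPoly m v ∧
      toPoly m v ∈ degreeLT k (m - atInfty x * t) := by
  cases x with
  | affine 𝔪 => exact mk_toPoly_eq_zero_iff 𝔪 t v
  | infty => exact mk_toPoly_rev_eq_zero_iff t v

/-- The morphism to a direct sum with given components. -/
def Hom.pi {r : ℕ} {M : KroneckerModule k} {Y : Fin r → KroneckerModule k}
    (f : ∀ i, Hom M (Y i)) : Hom M (directSum Y) where
  φ₁ := LinearMap.pi fun i => (f i).φ₁
  φ₂ := LinearMap.pi fun i => (f i).φ₂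
  comm_a := LinearMap.ext fun v => funext fun i => LinearMap.congr_fun (f i).comm_a v
  comm_b := LinearMap.ext fun v => funext fun i => LinearMap.congr_fun (f i).comm_b v

theorem sum_atInfty {r : ℕ} {x : Fin r → ClosedPoint k} (hx : Function.Injective x)
    (t : Fin r → ℕ) : (∑ i, atInfty (x i) * t i = 0) ∨
      ∃ i, ∑ i, atInfty (x i) * t i = atInfty (x i) * t i := by
  by_cases h : ∃ i, x i = .infty
  · obtain ⟨i, hi⟩ := h
    refine Or.inr ⟨i, Finset.sum_eq_single i (fun j _ hj => ?_) (by simp)⟩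
    cases hxj : x j with
    | affine 𝔪 => exact zero_mul _
    | infty => exact absurd (hx (hxj.trans hi.symm)) hj
  · refine Or.inl (Finset.sum_eq_zero fun i _ => ?_)
    cases hxi : x i with
    | affine 𝔪 => exact zero_mul _
    | infty => exact absurd ⟨i, hxi⟩ h

theorem finrank_directSum_R {r : ℕ} (x : Fin r → ClosedPoint k) (t : Fin r → ℕ) {F : k[X]}
    (hF : Associated F (∏ i, pointPoly (x i) ^ t i)) :
    ∑ i, finrank k (R (x i) (t i)).V₁ = F.natDegree + ∑ i, atInfty (x i) * t i := by
  rw [natDegree_eq_of_degree_eq (degree_eq_degree_of_associated hF),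
    natDegree_prod _ _ fun i _ => pow_ne_zero _ (pointPoly_ne_zero _), ← Finset.sum_add_distrib]
  exact Finset.sum_congr rfl fun i _ => by rw [finrank_R, natDegree_pow]

/-- This is the Chinese remainder theorem for binary forms. Coprimality combines the divisibilities
into `F ∣ q`. The bound at infinity leaves room for a cofactor of degree less than `n`, since `m` is
`n + deg F` plus the multiplicity at infinity. -/
theorem forall_dvd_and_mem_degreeLT_iff {r : ℕ} {x : Fin r → ClosedPoint k}
    (hx : Function.Injective x) (t : Fin r → ℕ) {F : k[X]}
    (hF : Associated F (∏ i, pointPoly (x i) ^ t i)) {n m : ℕ}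
    (hd : n + ∑ i, finrank k (R (x i) (t i)).V₁ = m) {q : k[X]} (hq : q ∈ degreeLT k m) :
    (∀ i, pointPoly (x i) ^ t i ∣ q ∧ q ∈ degreeLT k (m - atInfty (x i) * t i)) ↔
      ∃ w, F * toPoly n w = q := by
  rw [finrank_directSum_R x t hF] at hd
  have hF0 : F ≠ 0 := fun h0 => Finset.prod_ne_zero_iff.2
    (fun i _ => pow_ne_zero (t i) (pointPoly_ne_zero (x i))) (associated_zero_iff_eq_zero _ |>.1
      (h0 ▸ hF.symm))
  have hdeg : ∀ h : k[X], F * h ∈ degreeLT k (m - ∑ i, atInfty (x i) * t i) ↔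
      h ∈ degreeLT k n := fun h => by
    by_cases h0 : h = 0
    · simp [h0]
    · rw [mem_degreeLT, mem_degreeLT, degree_eq_natDegree h0,
        degree_eq_natDegree (mul_ne_zero hF0 h0), natDegree_mul hF0 h0, Nat.cast_lt, Nat.cast_lt]
      omega
  constructor
  · intro h
    -- The points are distinct, so at most one is infinity and the total multiplicity there is a
    -- single term or zero.
    have hmem : q ∈ degreeLT k (m - ∑ i, atInfty (x i) * t i) := by
      rcases sum_atInfty hx t with h0 | ⟨i, hi⟩
      · rwa [h0]
      · rw [hi]
        exact (h i).2
    obtain ⟨g, rfl⟩ : F ∣ q := hF.dvd.trans (Finset.prod_dvd_of_coprime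
      (fun i _ j _ hij => (isCoprime_pointPoly (hx.ne hij)).pow) fun i _ => (h i).1)
    obtain ⟨w, rfl⟩ := exists_toPoly_eq ((hdeg g).1 hmem)
    exact ⟨w, rfl⟩
  · rintro ⟨w, rfl⟩ i
    refine ⟨((Finset.dvd_prod_of_mem (fun i => pointPoly (x i) ^ t i)
      (Finset.mem_univ i)).trans hF.symm.dvd).mul_right _,
      degreeLT_mono ?_ ((hdeg _).2 (toPoly_mem w))⟩
    exact Nat.sub_le_sub_left (Finset.single_le_sum (f := fun i => atInfty (x i) * t i)
      (fun _ _ => Nat.zero_le _) (Finset.mem_univ i)) _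

/-- Both directions of the main theorem rest on this. The kernel is computed at each vertex by the
Chinese remainder lemma, with `n + 1`, `m + 1` at vertex 1 and `n`, `m` at vertex 2. -/
theorem exists_isShortExact {r : ℕ} {x : Fin r → ClosedPoint k}
    (hx : Function.Injective x) (t : Fin r → ℕ) {F : k[X]}
    (hF : Associated F (∏ i, pointPoly (x i) ^ t i)) {n m : ℕ}
    (hd : n + ∑ i, finrank k (R (x i) (t i)).V₁ = m) (f : Hom (P k n) (P k m))
    (hf₁ : ∀ v, toPoly (m + 1) (f.φ₁ v) = F * toPoly (n + 1) v)
    (hf₂ : ∀ v, toPoly m (f.φ₂ v) = F * toPoly n v) :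
    ∃ g : Hom (P k m) (directSum fun i => R (x i) (t i)), IsShortExact f g := by
  have hF0 : F ≠ 0 := fun h0 => Finset.prod_ne_zero_iff.2
    (fun i _ => pow_ne_zero (t i) (pointPoly_ne_zero (x i))) (associated_zero_iff_eq_zero _ |>.1
      (h0 ▸ hF.symm))
  have hinj₁ : Function.Injective f.φ₁ := fun v w h => toPoly_injective _
    (mul_left_cancel₀ hF0 ((hf₁ v).symm.trans ((congrArg (toPoly (m + 1)) h).trans (hf₁ w))))
  have hinj₂ : Function.Injective f.φ₂ := fun v w h => toPoly_injective _
    (mul_left_cancel₀ hF0 ((hf₂ v).symm.trans ((congrArg (toPoly m) h).trans (hf₂ w))))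
  let g : Hom (P k m) (directSum fun i => R (x i) (t i)) := Hom.pi fun i => homR m (x i) (t i)
  have hex₁ : Function.Exact f.φ₁ g.φ₁ := fun v => by
    refine funext_iff.trans ((forall_congr' fun i => homR_φ₁_eq_zero_iff m (x i) (t i) v).trans
      ((forall_dvd_and_mem_degreeLT_iff hx t hF (n := n + 1) (by omega) (toPoly_mem v)).trans
        (exists_congr fun w => ?_)))
    exact ⟨fun h => toPoly_injective _ ((hf₁ w).trans h),
      fun h => (hf₁ w).symm.trans (congrArg (toPoly (m + 1)) h)⟩
  have hex₂ : Function.Exact f.φ₂ g.φ₂ := fun v => by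
    refine funext_iff.trans ((forall_congr' fun i => homR_φ₂_eq_zero_iff m (x i) (t i) v).trans
      ((forall_dvd_and_mem_degreeLT_iff hx t hF hd (toPoly_mem v)).trans
        (exists_congr fun w => ?_)))
    exact ⟨fun h => toPoly_injective _ ((hf₂ w).trans h),
      fun h => (hf₂ w).symm.trans (congrArg (toPoly m) h)⟩
  refine ⟨g, ⟨hinj₁, hex₁, surjective_of_exact_of_finrank hinj₁ hex₁ ?_⟩,
    ⟨hinj₂, hex₂, surjective_of_exact_of_finrank hinj₂ hex₂ ?_⟩⟩
  · change finrank k (Fin (m + 1) → k) =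
      finrank k (Fin (n + 1) → k) + finrank k (∀ i, (R (x i) (t i)).V₁)
    rw [finrank_fin_fun, finrank_fin_fun, finrank_pi_fintype]
    omega
  · change finrank k (Fin m → k) = finrank k (Fin n → k) + finrank k (∀ i, (R (x i) (t i)).V₂)
    rw [finrank_fin_fun, finrank_fin_fun, finrank_pi_fintype]
    simp_rw [← finrank_R_eq]
    exact hd.symm

/-! ### Morphisms between preprojectives and factorisation of forms -/

/-- Multiplication by a polynomial, on vectors of coefficients. -/
noncomputable def mulVec (F : k[X]) (n m : ℕ) : (Fin n → k) →ₗ[k] (Fin m → k) where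
  toFun v i := (F * toPoly n v).coeff i
  map_add' v w := funext fun i => by simp [mul_add]
  map_smul' c v := funext fun i => by simp

theorem toPoly_mulVec {F : k[X]} {n m : ℕ} (h : n + F.natDegree ≤ m) (v : Fin n → k) :
    toPoly m (mulVec F n m v) = F * toPoly n v := by
  obtain ⟨w, hw⟩ : ∃ w, toPoly m w = F * toPoly n v := by
    refine exists_toPoly_eq (mem_degreeLT.2 ?_)
    by_cases hF : F = 0
    · simp [hF, bot_lt_iff_ne_bot]
    · calc (F * toPoly n v).degree = F.natDegree + (toPoly n v).degree := by
            rw [degree_mul, degree_eq_natDegree hF]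
        _ < F.natDegree + (n : WithBot ℕ) :=
            WithBot.add_lt_add_left (by simp) (mem_degreeLT.1 (toPoly_mem v))
        _ ≤ m := by exact_mod_cast (add_comm _ _).trans_le h
  rw [← hw]
  congr 1
  ext i
  rw [← toPoly_coeff w, hw]
  rfl

/-- The morphism from `Pₙ` to `Pₘ` given by multiplication by a polynomial. -/
noncomputable def mulHom (F : k[X]) {n m : ℕ} (h : n + F.natDegree ≤ m) :
    Hom (P k n) (P k m) where
  φ₁ := mulVec F (n + 1) (m + 1)
  φ₂ := mulVec F n m
  comm_a := LinearMap.ext fun (v : Fin n → k) => toPoly_injective (m + 1) <| by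
    change toPoly (m + 1) (mulVec F (n + 1) (m + 1) (Matrix.toLin' (upperBlock k n) v)) =
      toPoly (m + 1) (Matrix.toLin' (upperBlock k m) (mulVec F n m v))
    rw [toPoly_mulVec (by omega), toPoly_upperBlock, toPoly_upperBlock, toPoly_mulVec h]
  comm_b := LinearMap.ext fun (v : Fin n → k) => toPoly_injective (m + 1) <| by
    change toPoly (m + 1) (mulVec F (n + 1) (m + 1) (Matrix.toLin' (lowerBlock k n) v)) =
      toPoly (m + 1) (Matrix.toLin' (lowerBlock k m) (mulVec F n m v))
    rw [toPoly_mulVec (by omega), toPoly_lowerBlock, toPoly_lowerBlock, toPoly_mulVec h,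
      mul_left_comm]

/-- Every morphism from `Pₙ` to `Pₘ` is given by multiplication by a polynomial. -/
theorem exists_hom_apply_eq_mul {n m : ℕ} (f : Hom (P k n) (P k m)) :
    ∃ F : k[X], (∀ v, toPoly (m + 1) (f.φ₁ v) = F * toPoly (n + 1) v) ∧
      ∀ v, toPoly m (f.φ₂ v) = F * toPoly n v := by
  let f₁ : (Fin (n + 1) → k) →ₗ[k] (Fin (m + 1) → k) := f.φ₁
  let f₂ : (Fin n → k) →ₗ[k] (Fin m → k) := f.φ₂
  have ha : ∀ v, toPoly (m + 1) (f₁ (Matrix.toLin' (upperBlock k n) v)) = toPoly m (f₂ v) :=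
    fun v => (congrArg (toPoly (m + 1)) (LinearMap.congr_fun f.comm_a v)).trans
      (toPoly_upperBlock m (f₂ v))
  have hb : ∀ v, toPoly (m + 1) (f₁ (Matrix.toLin' (lowerBlock k n) v)) = X * toPoly m (f₂ v) :=
    fun v => (congrArg (toPoly (m + 1)) (LinearMap.congr_fun f.comm_b v)).trans
      (toPoly_lowerBlock m (f₂ v))
  have h₁ : ∀ v, toPoly (m + 1) (f₁ v) = toPoly (m + 1) (f₁ (Pi.single 0 1)) * toPoly (n + 1) v :=
    fun v => (map_eq_toPoly_smul (toPoly (m + 1) ∘ₗ f₁) (toPoly m ∘ₗ f₂) ha hb v).trans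
      (mul_comm _ _)
  refine ⟨_, h₁, fun (v : Fin n → k) => (ha v).symm.trans ?_⟩
  rw [h₁, toPoly_upperBlock]

theorem IsShortExact.isIso {L M N N' : KroneckerModule k} {f : Hom L M} {g : Hom M N}
    {g' : Hom M N'} (h : IsShortExact f g) (h' : IsShortExact f g') : N.IsIso N' := by
  obtain ⟨⟨-, e₁, s₁⟩, -, e₂, s₂⟩ := h
  obtain ⟨⟨-, e₁', s₁'⟩, -, e₂', s₂'⟩ := h'
  let i₁ := ((g.φ₁.quotKerEquivOfSurjective s₁).symm.trans (Submodule.quotEquivOfEq _ _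
    (e₁.linearMap_ker_eq.trans e₁'.linearMap_ker_eq.symm))).trans
      (g'.φ₁.quotKerEquivOfSurjective s₁')
  let i₂ := ((g.φ₂.quotKerEquivOfSurjective s₂).symm.trans (Submodule.quotEquivOfEq _ _
    (e₂.linearMap_ker_eq.trans e₂'.linearMap_ker_eq.symm))).trans
      (g'.φ₂.quotKerEquivOfSurjective s₂')
  have h₁ : ∀ v, i₁ (g.φ₁ v) = g'.φ₁ v := fun v => by
    have : (g.φ₁.quotKerEquivOfSurjective s₁).symm (g.φ₁ v) = Submodule.Quotient.mk v := by
      rw [LinearEquiv.symm_apply_eq]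
      rfl
    simp only [i₁, LinearEquiv.trans_apply, this]
    rfl
  have h₂ : ∀ v, i₂ (g.φ₂ v) = g'.φ₂ v := fun v => by
    have : (g.φ₂.quotKerEquivOfSurjective s₂).symm (g.φ₂ v) = Submodule.Quotient.mk v := by
      rw [LinearEquiv.symm_apply_eq]
      rfl
    simp only [i₂, LinearEquiv.trans_apply, this]
    rfl
  refine ⟨i₁, i₂, fun w => ?_, fun w => ?_⟩
  · obtain ⟨v, rfl⟩ := s₂ w
    rw [h₂, ← LinearMap.comp_apply, ← g.comm_a, LinearMap.comp_apply, h₁]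
    exact LinearMap.congr_fun g'.comm_a v
  · obtain ⟨v, rfl⟩ := s₂ w
    rw [h₂, ← LinearMap.comp_apply, ← g.comm_b, LinearMap.comp_apply, h₁]
    exact LinearMap.congr_fun g'.comm_b v

/-- The point of the affine line defined by an irreducible polynomial. -/
noncomputable def affinePoint {p : k[X]} (hp : Irreducible p) : ClosedPoint k :=
  .affine ⟨Ideal.span {p}, PrincipalIdealRing.isMaximal_of_irreducible hp⟩

theorem associated_pointPoly {p : k[X]} (hp : Irreducible p) :
    Associated (pointPoly (affinePoint hp)) p :=
  Ideal.span_singleton_eq_span_singleton.1 (span_generator _)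

theorem associated_of_affinePoint_eq {p q : k[X]} {hp : Irreducible p} {hq : Irreducible q}
    (h : affinePoint hp = affinePoint hq) : Associated p q :=
  Ideal.span_singleton_eq_span_singleton.1
    (congrArg MaximalSpectrum.asIdeal (ClosedPoint.affine.inj h))

theorem exists_associated_prod_affine {F : k[X]} (hF : F ≠ 0) :
    ∃ (r : ℕ) (x : Fin r → ClosedPoint k) (t : Fin r → ℕ), Function.Injective x ∧
      (∀ i, x i ≠ .infty) ∧ (∀ i, 1 ≤ t i) ∧ Associated F (∏ i, pointPoly (x i) ^ t i) := by
  classical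
  let N := UniqueFactorizationMonoid.normalizedFactors F
  have hirr : ∀ p : N.toFinset, Irreducible p.1 := fun p =>
    UniqueFactorizationMonoid.irreducible_of_normalized_factor _ (Multiset.mem_toFinset.1 p.2)
  have hnorm : ∀ p : N.toFinset, normalize p.1 = p.1 := fun p =>
    UniqueFactorizationMonoid.normalize_normalized_factor _ (Multiset.mem_toFinset.1 p.2)
  let e := N.toFinset.equivFin.symm
  refine ⟨_, fun i => affinePoint (hirr (e i)), fun i => N.count (e i).1, fun i j h => ?_,
    fun i h => ?_, fun i => Multiset.one_le_count_iff_mem.2 (Multiset.mem_toFinset.1 (e i).2), ?_⟩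
  · apply e.injective
    apply Subtype.ext
    rw [← hnorm (e i), ← hnorm (e j), normalize_eq_normalize_iff_associated]
    exact associated_of_affinePoint_eq h
  · cases h
  · refine (UniqueFactorizationMonoid.prod_normalizedFactors hF).symm.trans ?_
    rw [Finset.prod_multiset_count, ← Finset.prod_coe_sort, ← e.prod_comp]
    exact Associated.prod _ _ _ fun i _ => (associated_pointPoly (hirr (e i))).symm.pow_pow

/-- The degree missing from `d` is the multiplicity at infinity. That point is added only when the
deficit is positive, to keep every exponent at least one. -/
theorem exists_associated_prod {F : k[X]} (hF : F ≠ 0) {d : ℕ} (hd : F.natDegree ≤ d) :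
    ∃ (r : ℕ) (x : Fin r → ClosedPoint k) (t : Fin r → ℕ), Function.Injective x ∧
      (∀ i, 1 ≤ t i) ∧ Associated F (∏ i, pointPoly (x i) ^ t i) ∧
      F.natDegree + ∑ i, atInfty (x i) * t i = d := by
  obtain ⟨r, x, t, hx, hinf, ht, hA⟩ := exists_associated_prod_affine hF
  have h0 : ∑ i, atInfty (x i) * t i = 0 := Finset.sum_eq_zero fun i _ => by
    cases hxi : x i with
    | affine 𝔪 => exact zero_mul _
    | infty => exact absurd hxi (hinf i)
  rcases hd.eq_or_lt with hd | hd
  · exact ⟨r, x, t, hx, ht, hA, by rw [h0, add_zero, hd]⟩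
  · refine ⟨r + 1, Fin.cons .infty x, Fin.cons (d - F.natDegree) t, ?_, ?_, ?_, ?_⟩
    · exact Fin.cons_injective_iff.2 ⟨fun ⟨i, hi⟩ => hinf i hi, hx⟩
    · exact Fin.cases (by simp only [Fin.cons_zero]; omega) ht
    · simpa [Fin.prod_univ_succ, pointPoly] using hA
    · simp only [Fin.sum_univ_succ, Fin.cons_zero, Fin.cons_succ, h0]
      simp only [atInfty]
      omega

/-! ### Dimension vectors and the two implications -/

theorem finrank_directSum {r : ℕ} (Y : Fin r → KroneckerModule k) :
    finrank k (directSum Y).V₁ = ∑ i, finrank k (Y i).V₁ ∧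
      finrank k (directSum Y).V₂ = ∑ i, finrank k (Y i).V₂ :=
  ⟨finrank_pi_fintype k, finrank_pi_fintype k⟩

theorem dimVec_P_sub (n m : ℕ) :
    (P k m).dimVec - (P k n).dimVec = ((m : ℤ) - n, (m : ℤ) - n) := by
  have h₁ : ∀ n, finrank k (P k n).V₁ = n + 1 := fun n => finrank_fin_fun k
  have h₂ : ∀ n, finrank k (P k n).V₂ = n := fun n => finrank_fin_fun k
  simp only [dimVec, h₁, h₂]
  ext <;> push_cast <;> simp

theorem IsShortExact.dimVec_eq {L M N : KroneckerModule k} {f : Hom L M} {g : Hom M N}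
    (h : IsShortExact f g) : N.dimVec = M.dimVec - L.dimVec := by
  obtain ⟨⟨i₁, e₁, s₁⟩, i₂, e₂, s₂⟩ := h
  have h₁ := LinearMap.finrank_range_add_finrank_ker g.φ₁
  have h₂ := LinearMap.finrank_range_add_finrank_ker g.φ₂
  rw [e₁.linearMap_ker_eq, LinearMap.finrank_range_of_inj i₁, LinearMap.range_eq_top.2 s₁,
    finrank_top] at h₁
  rw [e₂.linearMap_ker_eq, LinearMap.finrank_range_of_inj i₂, LinearMap.range_eq_top.2 s₂,
    finrank_top] at h₂
  ext
  · simp only [dimVec, Prod.fst_sub]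
    omega
  · simp only [dimVec, Prod.snd_sub]
    omega

theorem natDegree_le_of_apply_eq_mul {n m : ℕ} {F : k[X]} (hF : F ≠ 0) (f : Hom (P k n) (P k m))
    (hf : ∀ v, toPoly (m + 1) (f.φ₁ v) = F * toPoly (n + 1) v) : n + F.natDegree ≤ m := by
  have h : F * X ^ n ∈ degreeLT k (m + 1) := by
    -- The last basis vector is `X ^ n`, the element of top degree, so its image gives the sharp
    -- bound.
    have h₁ := hf (Pi.single (Fin.last n) 1 : Fin (n + 1) → k)
    have h₂ : toPoly (n + 1) (Pi.single (Fin.last n) 1 : Fin (n + 1) → k) = X ^ n :=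
      toPoly_single _
    rw [← h₂]
    exact h₁ ▸ toPoly_mem _
  rw [mem_degreeLT, degree_eq_natDegree (mul_ne_zero hF (pow_ne_zero n X_ne_zero)),
    natDegree_mul_X_pow n hF, Nat.cast_lt] at h
  omega

/-- Injectivity makes `F` nonzero. Its factorisation provides a second cokernel of the same `f`, and
cokernels are unique up to isomorphism. -/
theorem IsShortExact.isRegular {n m : ℕ} {M : KroneckerModule k} {f : Hom (P k n) (P k m)}
    {g : Hom (P k m) M} (h : IsShortExact f g) : M.IsRegular := by
  obtain ⟨F, hf₁, hf₂⟩ := exists_hom_apply_eq_mul f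
  have hF : F ≠ 0 := by
    rintro rfl
    let v : Fin (n + 1) → k := Pi.single 0 1
    let z : Fin (n + 1) → k := 0
    have h0 : f.φ₁ v = f.φ₁ z := toPoly_injective (m + 1)
      ((hf₁ v).trans ((zero_mul _).trans ((hf₁ z).trans (zero_mul _)).symm))
    have h1 : v 0 = z 0 := congrFun (h.1.1 h0) 0
    simp [v, z] at h1
  have hdeg := natDegree_le_of_apply_eq_mul hF f hf₁
  obtain ⟨r, x, t, hx, ht, hA, hd⟩ := exists_associated_prod hF (Nat.le_sub_of_add_le' hdeg)
  obtain ⟨g', hg'⟩ := exists_isShortExact hx t hA (n := n) (m := m)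
    (by rw [finrank_directSum_R x t hA, hd]; omega) f hf₁ hf₂
  exact ⟨r, _, fun i => isRegularIndecomposable_R (x i) (ht i), h.isIso hg'⟩

/-- No summand is preinjective, so each has `dim V₂ ≤ dim V₁`. Equality of the sums makes every one
of these an equality. -/
theorem exists_inTube_of_finrank_eq {M : KroneckerModule k} {r : ℕ} {Y : Fin r → KroneckerModule k}
    (hY : ∀ i, (Y i).IsRegularIndecomposable) (hM : M.IsIso (directSum Y))
    (hd : finrank k M.V₁ = finrank k M.V₂) (i : Fin r) : ∃ x, InTube x (Y i) := by
  rw [hM.finrank₁, hM.finrank₂, (finrank_directSum Y).1, (finrank_directSum Y).2] at hd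
  have hle : ∀ i ∈ Finset.univ, finrank k (Y i).V₂ ≤ finrank k (Y i).V₁ := fun i _ => by
    by_contra! hlt
    obtain ⟨n, hn⟩ := (hY i).1.trivialIdempotents.exists_isIso_I hlt
    exact (hY i).2.2 n hn
  exact (hY i).1.exists_inTube
    ((Finset.sum_eq_sum_iff_of_le hle).1 hd.symm i (Finset.mem_univ i)).symm

theorem exists_isShortExact_of_isRegular {n m : ℕ} {M : KroneckerModule k}
    (hM : M.IsRegular) (hd : M.dimVec = (P k m).dimVec - (P k n).dimVec)
    (ht : M.SummandsInDistinctTubes) :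
    ∃ (f : Hom (P k n) (P k m)) (g : Hom (P k m) M), IsShortExact f g := by
  rw [dimVec_P_sub] at hd
  have hd₁ : (finrank k M.V₁ : ℤ) = m - n := congrArg Prod.fst hd
  have hd₂ : (finrank k M.V₂ : ℤ) = m - n := congrArg Prod.snd hd
  obtain ⟨r, Y, hY, hiso⟩ := hM
  choose x hx using exists_inTube_of_finrank_eq hY hiso (by omega)
  have hinj : Function.Injective x := fun i j hij => by_contra fun hne =>
    ht r Y (fun i => (hY i).1) hiso i j hne (x i) (x j) (hx i) (hx j) hij
  choose t _ hYR using hx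
  have hMR : M.IsIso (directSum fun i => R (x i) (t i)) := hiso.trans (IsIso.directSum hYR)
  have hsum : n + ∑ i, finrank k (R (x i) (t i)).V₁ = m := by
    rw [← (finrank_directSum fun i => R (x i) (t i)).1, ← hMR.finrank₁]
    omega
  -- The factor at infinity is `1`, so that multiplicity enters only as the gap between `n + deg F`
  -- and `m`.
  let F := ∏ i, pointPoly (x i) ^ t i
  have hF := finrank_directSum_R x t (Associated.refl F)
  have hdeg : n + F.natDegree ≤ m := by omega
  obtain ⟨g, hg₁, hg₂⟩ := exists_isShortExact hinj t (Associated.refl F) hsum (mulHom F hdeg)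
    (toPoly_mulVec (by omega)) (toPoly_mulVec hdeg)
  obtain ⟨e, he₁, he₂⟩ := hMR.symm.exists_hom
  refine ⟨mulHom F hdeg, e.comp g, ⟨hg₁.1, fun v => ?_, he₁.2.comp hg₁.2.2⟩,
    ⟨hg₂.1, fun v => ?_, he₂.2.comp hg₂.2.2⟩⟩
  · exact (map_eq_zero_iff e.φ₁ he₁.1).trans (hg₁.2.1 v)
  · exact (map_eq_zero_iff e.φ₂ he₂.1).trans (hg₂.2.1 v)

end KroneckerModule

theorem mainTheorem8 {k : Type*} [Field k] (n m : ℕ) (hnm : n < m) (X : KroneckerModule k) :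
    (∃ (f : KroneckerModule.Hom (KroneckerModule.P k n) (KroneckerModule.P k m))
        (g : KroneckerModule.Hom (KroneckerModule.P k m) X),
        KroneckerModule.IsShortExact f g) ↔
      (X.IsRegular ∧
          X.dimVec = (KroneckerModule.P k m).dimVec - (KroneckerModule.P k n).dimVec) ∧
        X.SummandsInDistinctTubes := by
  constructor
  · rintro ⟨f, g, h⟩
    exact ⟨⟨h.isRegular, h.dimVec_eq⟩,
      KroneckerModule.summandsInDistinctTubes_of_surjective g h.1.2.2⟩
  · rintro ⟨⟨hreg, hdim⟩, htubes⟩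
    exact KroneckerModule.exists_isShortExact_of_isRegular hreg hdim htubes
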